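/- Conventions. All Hilbert spaces are finite-dimensional and complex. A quantum channel $\Phi:\mathrm{End}(H)\to\mathrm{End}(K)$ is a completely positive trace-preserving linear map; its minimal output entropy is $S_{\min}(\Phi)=\min_{w\in H,\ \|w\|=1}S(\Phi(ww^{*}))$, where $S(\varrho)=-\mathrm{tr}(\varrho\log_2\varrho)$. For $m\in\mathbb{N}=\{0,1,2,\dots\}$, $P_m$ is the space of complex homogeneous polynomials of degree $m$ in $x_1,x_2$, with the inner product $\langle x_1^{l}x_2^{m-l},x_1^{k}x_2^{m-k}\rangle=l!\,(m-l)!\,\delta_{lk}$ and the irreducible unitary representation $(\rho_m(g)f)(x)=f(xg)$ of $SU(2)$, where $x=(x_1,x_2)$ is a row vector. A channel $\Phi:\mathrm{End}(H)\to\mathrm{End}(K)$ between representations $\pi,\sigma$ of $SU(2)$ on $H,K$ is $SU(2)$-covariant if $\Phi(\pi(g)A\pi(g)^{*})=\sigma(g)\Phi(A)\sigma(g)^{*}$ for all $g\in SU(2)$ and $A\in\mathrm{End}(H)$, and $SU(2)$-irreducibly covariant if moreover $\pi$ and $\sigma$ are irreducible. Statement. Let $r_1,r_2,m_1,m_2\in\mathbb{N}$,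 and let $\Phi_1:\mathrm{End}(P_{r_1})\to\mathrm{End}(P_{m_1})$ and $\Phi_2:\mathrm{End}(P_{r_2})\to\mathrm{End}(P_{m_2})$ be $SU(2)$-covariant channels. Let $P_{r_1}\otimes P_{r_2}=\bigoplus_{k=0}^{\min\{r_1,r_2\}}V_k$ and $P_{m_1}\otimes P_{m_2}=\bigoplus_{l=0}^{\min\{m_1,m_2\}}W_l$ be the Clebsch–Gordan decompositions into irreducible $SU(2)$-invariant subspaces, $V_k\cong P_{r_1+r_2-2k}$ and $W_l\cong P_{m_1+m_2-2l}$; let $q_l$ be the orthogonal projection of $P_{m_1}\otimes P_{m_2}$ onto $W_l$, and let $E(A)=\sum_{l}q_lAq_l$ for $A\in\mathrm{End}(P_{m_1}\otimes P_{m_2})$. Regard operators on a subspace as operators on the whole space that vanish on its orthogonal complement. Then for every $0\le k\le\min\{r_1,r_2\}$ there exist $SU(2)$-irreducibly covariant channels $\psi_{k,l}:\mathrm{End}(V_k)\to\mathrm{End}(W_l)$ and real numbers $\lambda_{k,l}\ge 0$, $0\le l\le\min\{m_1,m_2\}$, with $\sum_l\lambda_{k,l}=1$, such that $$E\circ(\Phi_1\otimes\Phi_2)|_{\mathrm{End}(V_k)}=\sum_{l=0}^{\min\{m_1,m_2\}}\lambda_{k,l}\,\psi_{k,l}$$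 and $$S_{\min}(\Phi_1\otimes\Phi_2)\le S_{\min}\Big(\sum_{l=0}^{\min\{m_1,m_2\}}\lambda_{k,l}\,\psi_{k,l}\Big).$$ -/

import Mathlib

open scoped TensorProduct InnerProductSpace ComplexConjugate

noncomputable section

namespace SU2Channels

/-! ### Quantum channels and minimal output entropy

All Hilbert spaces are finite dimensional complex inner product spaces, and `Module.End ℂ H` is the
algebra of all linear operators on `H`. -/

section Channels

variable {H K H₁ H₂ K₁ K₂ : Type*}
  [NormedAddCommGroup H] [InnerProductSpace ℂ H] [FiniteDimensional ℂ H]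
  [NormedAddCommGroup K] [InnerProductSpace ℂ K] [FiniteDimensional ℂ K]
  [NormedAddCommGroup H₁] [InnerProductSpace ℂ H₁] [FiniteDimensional ℂ H₁]
  [NormedAddCommGroup H₂] [InnerProductSpace ℂ H₂] [FiniteDimensional ℂ H₂]
  [NormedAddCommGroup K₁] [InnerProductSpace ℂ K₁] [FiniteDimensional ℂ K₁]
  [NormedAddCommGroup K₂] [InnerProductSpace ℂ K₂] [FiniteDimensional ℂ K₂]

/-- The tensor product `Φ₁ ⊗ Φ₂ : End(H₁ ⊗ H₂) → End(K₁ ⊗ K₂)` of two linear maps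
`Φᵢ : End(Hᵢ) → End(Kᵢ)`, i.e. the linear extension of `A ⊗ B ↦ Φ₁(A) ⊗ Φ₂(B)`, under the
canonical identification `End(H₁) ⊗ End(H₂) = End(H₁ ⊗ H₂)`. -/
def tensorMap (Φ₁ : Module.End ℂ H₁ →ₗ[ℂ] Module.End ℂ K₁)
    (Φ₂ : Module.End ℂ H₂ →ₗ[ℂ] Module.End ℂ K₂) :
    Module.End ℂ (H₁ ⊗[ℂ] H₂) →ₗ[ℂ] Module.End ℂ (K₁ ⊗[ℂ] K₂) :=
  (homTensorHomEquiv ℂ K₁ K₂ K₁ K₂).toLinearMap ∘ₗ TensorProduct.map Φ₁ Φ₂ ∘ₗ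
    (homTensorHomEquiv ℂ H₁ H₂ H₁ H₂).symm.toLinearMap

/-- The defining property of `tensorMap`. -/
theorem tensorMap_map (Φ₁ : Module.End ℂ H₁ →ₗ[ℂ] Module.End ℂ K₁)
    (Φ₂ : Module.End ℂ H₂ →ₗ[ℂ] Module.End ℂ K₂) (A : Module.End ℂ H₁) (B : Module.End ℂ H₂) :
    tensorMap Φ₁ Φ₂ (TensorProduct.map A B) = TensorProduct.map (Φ₁ A) (Φ₂ B) := by
  have h : (homTensorHomEquiv ℂ H₁ H₂ H₁ H₂).symm (TensorProduct.map A B) = A ⊗ₜ[ℂ] B := by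
    rw [LinearEquiv.symm_apply_eq, homTensorHomEquiv_apply]
    rfl
  simp only [tensorMap, LinearMap.comp_apply, LinearEquiv.coe_coe]
  rw [h, TensorProduct.map_tmul, homTensorHomEquiv_apply]
  rfl

/-- `Φ` is completely positive: for every `n`, the map `Φ ⊗ id : End(H ⊗ ℂⁿ) → End(K ⊗ ℂⁿ)` sends
positive (semidefinite) operators to positive operators. -/
def IsCompletelyPositive (Φ : Module.End ℂ H →ₗ[ℂ] Module.End ℂ K) : Prop :=
  ∀ (n : ℕ) (A : Module.End ℂ (H ⊗[ℂ] EuclideanSpace ℂ (Fin n))), A.IsPositive →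
    (tensorMap Φ (LinearMap.id : Module.End ℂ (EuclideanSpace ℂ (Fin n)) →ₗ[ℂ] _) A).IsPositive

/-- A quantum channel: a completely positive trace preserving linear map `End(H) → End(K)`. -/
structure IsQuantumChannel (Φ : Module.End ℂ H →ₗ[ℂ] Module.End ℂ K) : Prop where
  completelyPositive : IsCompletelyPositive Φ
  trace_eq : ∀ A : Module.End ℂ H, LinearMap.trace ℂ K (Φ A) = LinearMap.trace ℂ H A

/-- The rank one operator `w w^*` on `H`; for a unit vector `w` this is a pure state. -/
def pureState (w : H) : Module.End ℂ H := (InnerProductSpace.rankOne ℂ w w).toLinearMap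

open Classical in
/-- The von Neumann entropy `S(ϱ) = -tr(ϱ log₂ ϱ) = -∑ λᵢ log₂ λᵢ`, the sum being over the
eigenvalues of the self-adjoint operator `ϱ` with multiplicity, and `0 log₂ 0 = 0`.
(The value `0` for an operator that is not self-adjoint is a dummy value.) -/
def entropy (ϱ : Module.End ℂ H) : ℝ :=
  if h : ϱ.IsSymmetric then -∑ i, h.eigenvalues rfl i * Real.logb 2 (h.eigenvalues rfl i) else 0

/-- The minimal output entropy of `Φ`: the minimum of `S(Φ(w w^*))` over all unit vectors `w`. For
a quantum channel on a nonzero space this infimum is over a nonempty set bounded below, and it is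
attained. -/
def minOutputEntropy (Φ : Module.End ℂ H →ₗ[ℂ] Module.End ℂ K) : ℝ :=
  ⨅ w : {w : H // ‖w‖ = 1}, entropy (Φ (pureState w.1))

/-- For a subspace `W` of `H`, the inclusion `End(W) ⊆ End(H)`, extending an operator by `0` on the
orthogonal complement of `W`. -/
def inclEnd (W : Submodule ℂ H) : Module.End ℂ W →ₗ[ℂ] Module.End ℂ H where
  toFun A := W.subtype ∘ₗ A ∘ₗ W.orthogonalProjectionOnto.toLinearMap
  map_add' A B := by ext x; simp
  map_smul' c A := by ext x; simp

/-- The pinching `A ↦ ∑ₗ qₗ A qₗ`, where `qₗ` is the orthogonal projection onto `W l`. -/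
def pinching {ι : Type*} [Fintype ι] (W : ι → Submodule ℂ H) :
    Module.End ℂ H →ₗ[ℂ] Module.End ℂ H where
  toFun A := ∑ l, (W l).starProjection.toLinearMap ∘ₗ A ∘ₗ (W l).starProjection.toLinearMap
  map_add' A B := by
    simp only [LinearMap.add_comp, LinearMap.comp_add, Finset.sum_add_distrib]
  map_smul' c A := by
    simp only [LinearMap.smul_comp, LinearMap.comp_smul, Finset.smul_sum, RingHom.id_apply]

/-- A `G`-covariant channel: a quantum channel with
`Φ(π(g) A π(g)^*) = σ(g) Φ(A) σ(g)^*` for all `g` and `A`. -/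
structure IsCovariantChannel {G : Type*} [Group G] (π : Representation ℂ G H)
    (σ : Representation ℂ G K) (Φ : Module.End ℂ H →ₗ[ℂ] Module.End ℂ K) : Prop where
  isQuantumChannel : IsQuantumChannel Φ
  covariant : ∀ (g : G) (A : Module.End ℂ H),
    Φ (π g ∘ₗ A ∘ₗ LinearMap.adjoint (π g)) = σ g ∘ₗ Φ A ∘ₗ LinearMap.adjoint (σ g)

/-- A `G`-irreducibly covariant channel: a `G`-covariant channel between irreducible
representations. -/
structure IsIrreduciblyCovariantChannel {G : Type*} [Group G] (π : Representation ℂ G H)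
    (σ : Representation ℂ G K) (Φ : Module.End ℂ H →ₗ[ℂ] Module.End ℂ K) : Prop
    extends IsCovariantChannel π σ Φ where
  irreducible_left : π.IsIrreducible
  irreducible_right : σ.IsIrreducible

end Channels

/-! ### The irreducible representations of `SU(2)` -/

/-- The group `SU(2)`. -/
abbrev SU2 : Type := Matrix.specialUnitaryGroup (Fin 2) ℂ

/-- The space `P m` of homogeneous polynomials of degree `m` in the two variables
`x₁ = X 0`, `x₂ = X 1` with complex coefficients. -/
def P (m : ℕ) : Type := MvPolynomial.homogeneousSubmodule (Fin 2) ℂ m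

namespace P

variable {m : ℕ}

/-- The vector space structure, used until the inner product has been set up. -/
abbrev polyAddCommGroup : AddCommGroup (P m) :=
  inferInstanceAs (AddCommGroup (MvPolynomial.homogeneousSubmodule (Fin 2) ℂ m))

attribute [local instance] polyAddCommGroup

/-- The vector space structure, used until the inner product has been set up. -/
abbrev polyModule : Module ℂ (P m) :=
  inferInstanceAs (Module ℂ (MvPolynomial.homogeneousSubmodule (Fin 2) ℂ m))

attribute [local instance] polyModule

/-- The underlying polynomial, as a linear map. -/
def toPoly (m : ℕ) : P m →ₗ[ℂ] MvPolynomial (Fin 2) ℂ :=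
  (MvPolynomial.homogeneousSubmodule (Fin 2) ℂ m).subtype

theorem toPoly_injective : Function.Injective (toPoly m) := Subtype.val_injective

theorem isHomogeneous (f : P m) : (toPoly m f).IsHomogeneous m := f.2

/-- The coefficient of `x₁ ^ l * x₂ ^ (m - l)`. -/
def coeff (f : P m) (l : Fin (m + 1)) : ℂ :=
  (toPoly m f).coeff (Finsupp.single 0 (l : ℕ) + Finsupp.single 1 (m - l))

theorem coeff_add (f g : P m) (l : Fin (m + 1)) : coeff (f + g) l = coeff f l + coeff g l := by
  simp [coeff]

theorem coeff_smul (c : ℂ) (f : P m) (l : Fin (m + 1)) : coeff (c • f) l = c * coeff f l := by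
  simp [coeff]

theorem eq_zero_of_coeff (f : P m) (h : ∀ l, coeff f l = 0) : f = 0 := by
  apply toPoly_injective
  rw [map_zero]
  ext d
  rw [MvPolynomial.coeff_zero]
  by_contra hd
  have hdeg : d 0 + d 1 = m := by
    have := (isHomogeneous f) hd
    simpa [Finsupp.weight_apply, Finsupp.sum_fintype] using this
  have h0 := h ⟨d 0, by omega⟩
  apply hd
  rw [← h0, coeff]
  congr 1
  ext i
  fin_cases i
  · simp
  · simp
    omega

/-- The inner product on `P m` in which the monomials `x₁ ^ l * x₂ ^ (m - l)` are orthogonal with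
`⟪x₁ ^ l * x₂ ^ (m - l), x₁ ^ l * x₂ ^ (m - l)⟫ = l! (m - l)!`. -/
abbrev core (m : ℕ) : InnerProductSpace.Core ℂ (P m) where
  inner f g := ∑ l : Fin (m + 1),
    ((l : ℕ).factorial * (m - l : ℕ).factorial : ℂ) * (conj (coeff f l) * coeff g l)
  conj_inner_symm f g := by
    simp only [map_sum, map_mul, Complex.conj_conj, map_natCast]
    exact Finset.sum_congr rfl fun l _ => by ring
  re_inner_nonneg f := by
    have h : ∀ l : Fin (m + 1), ((l : ℕ).factorial * (m - l : ℕ).factorial : ℂ) *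
        (conj (coeff f l) * coeff f l) =
        (((l : ℕ).factorial * (m - l : ℕ).factorial * Complex.normSq (coeff f l) : ℝ) : ℂ) := by
      intro l
      rw [mul_comm (conj _), Complex.mul_conj]
      push_cast
      ring
    simp only [h, ← Complex.ofReal_sum]
    rw [RCLike.re_eq_complex_re, Complex.ofReal_re]
    exact Finset.sum_nonneg fun l _ => mul_nonneg (by positivity) (Complex.normSq_nonneg _)
  definite f hf := by
    have h : ∀ l : Fin (m + 1), ((l : ℕ).factorial * (m - l : ℕ).factorial : ℂ) *
        (conj (coeff f l) * coeff f l) =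
        (((l : ℕ).factorial * (m - l : ℕ).factorial * Complex.normSq (coeff f l) : ℝ) : ℂ) := by
      intro l
      rw [mul_comm (conj _), Complex.mul_conj]
      push_cast
      ring
    simp only [h, ← Complex.ofReal_sum] at hf
    have hf' := Complex.ofReal_eq_zero.mp hf
    rw [Finset.sum_eq_zero_iff_of_nonneg
      (fun l _ => mul_nonneg (by positivity) (Complex.normSq_nonneg _))] at hf'
    apply eq_zero_of_coeff
    intro l
    have := hf' l (Finset.mem_univ l)
    have hne : ((l : ℕ).factorial * (m - l : ℕ).factorial : ℝ) ≠ 0 := by positivity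
    exact Complex.normSq_eq_zero.mp ((mul_eq_zero.mp this).resolve_left hne)
  add_left f g k := by
    simp only [coeff_add, map_add, add_mul, mul_add, Finset.sum_add_distrib]
  smul_left f g c := by
    simp only [coeff_smul, map_mul, Finset.mul_sum]
    exact Finset.sum_congr rfl fun l _ => by ring

instance : NormedAddCommGroup (P m) := (core m).toNormedAddCommGroup

instance : InnerProductSpace ℂ (P m) := InnerProductSpace.ofCore (core m).toCore

theorem inner_def (f g : P m) : ⟪f, g⟫_ℂ = ∑ l : Fin (m + 1),
    ((l : ℕ).factorial * (m - l : ℕ).factorial : ℂ) * (conj (coeff f l) * coeff g l) := rfl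

instance : FiniteDimensional ℂ (P m) := by
  let c : P m →ₗ[ℂ] (Fin (m + 1) → ℂ) :=
    { toFun := coeff
      map_add' := fun f g => funext fun l => coeff_add f g l
      map_smul' := fun a f => funext fun l => coeff_smul a f l }
  refine FiniteDimensional.of_injective c ((injective_iff_map_eq_zero c).mpr fun f hf => ?_)
  exact eq_zero_of_coeff f fun l => congrFun hf l

end P

/-- The substitution `f(x) ↦ f(x g)`, with `x = (x₁, x₂)` a row vector. -/
def subst (g : Matrix (Fin 2) (Fin 2) ℂ) :
    MvPolynomial (Fin 2) ℂ →ₐ[ℂ] MvPolynomial (Fin 2) ℂ :=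
  MvPolynomial.aeval fun j => ∑ i, MvPolynomial.C (g i j) * MvPolynomial.X i

theorem subst_isHomogeneous {m : ℕ} (g : Matrix (Fin 2) (Fin 2) ℂ) {f : MvPolynomial (Fin 2) ℂ}
    (hf : f.IsHomogeneous m) : (subst g f).IsHomogeneous m := by
  have := hf.aeval (S := ℂ) (n := 1)
    (fun j => ∑ i, MvPolynomial.C (g i j) * MvPolynomial.X i)
    (fun j => MvPolynomial.IsHomogeneous.sum _ _ _ fun i _ =>
      (MvPolynomial.isHomogeneous_X ℂ i).C_mul _)
  rwa [one_mul] at this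

theorem subst_one : subst 1 = AlgHom.id ℂ _ := by
  apply MvPolynomial.algHom_ext
  intro j
  simp [subst, Matrix.one_apply]

theorem subst_mul (g h : Matrix (Fin 2) (Fin 2) ℂ) :
    subst (g * h) = (subst g).comp (subst h) := by
  apply MvPolynomial.algHom_ext
  intro j
  fin_cases j <;>
  · simp [subst, Matrix.mul_apply, MvPolynomial.algHom_C]
    ring

/-- The representation `ρ m` of `SU(2)` on `P m`: `(ρ m g f)(x) = f(x g)`. -/
def ρ (m : ℕ) : Representation ℂ SU2 (P m) where
  toFun g := LinearMap.restrict (subst (g : Matrix (Fin 2) (Fin 2) ℂ)).toLinearMap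
    (p := MvPolynomial.homogeneousSubmodule (Fin 2) ℂ m)
    (q := MvPolynomial.homogeneousSubmodule (Fin 2) ℂ m)
    fun _ hf => subst_isHomogeneous _ hf
  map_one' := by
    apply LinearMap.ext
    intro f
    apply Subtype.ext
    change subst 1 f.1 = f.1
    rw [subst_one]
    rfl
  map_mul' g h := by
    apply LinearMap.ext
    intro f
    apply Subtype.ext
    change subst (g.1 * h.1) f.1 = subst g.1 (subst h.1 f.1)
    rw [subst_mul]
    rfl

/-- The defining property of `ρ`. -/
theorem toPoly_ρ (m : ℕ) (g : SU2) (f : P m) :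
    P.toPoly m (ρ m g f) = subst (g : Matrix (Fin 2) (Fin 2) ℂ) (P.toPoly m f) := rfl

/-- The `l`-th Clebsch–Gordan component of `P a ⊗ P b` (`0 ≤ l ≤ min a b`): the sum of the images of
all `SU(2)`-equivariant linear maps `P (a + b - 2 l) → P a ⊗ P b`, that is, the isotypic component
of type `P (a + b - 2 l)`. As `P a ⊗ P b` is multiplicity free, this is its unique
irreducible invariant subspace isomorphic to `P (a + b - 2 l)`. -/
def component (a b l : ℕ) : Subrepresentation ((ρ a).tprod (ρ b)) where
  toSubmodule := ⨆ T : Representation.IntertwiningMap (ρ (a + b - 2 * l)) ((ρ a).tprod (ρ b)),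
    LinearMap.range T.toLinearMap
  apply_mem_toSubmodule g v hv := by
    induction hv using Submodule.iSup_induction' with
    | mem T x hx =>
      obtain ⟨y, rfl⟩ := hx
      refine Submodule.mem_iSup_of_mem T ⟨ρ _ g y, ?_⟩
      exact LinearMap.congr_fun (T.isIntertwining' g) y
    | zero => rw [map_zero]; exact Submodule.zero_mem _
    | add x y _ _ hx hy => rw [map_add]; exact Submodule.add_mem _ hx hy

/-- The underlying subspace of the `l`-th Clebsch–Gordan component of `P a ⊗ P b`. -/
abbrev componentSpace (a b l : ℕ) : Submodule ℂ (P a ⊗[ℂ] P b) := (component a b l).toSubmodule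

instance (a b l : ℕ) : NormedAddCommGroup (componentSpace a b l) :=
  Submodule.normedAddCommGroup _

instance (a b l : ℕ) : InnerProductSpace ℂ (componentSpace a b l) :=
  Submodule.innerProductSpace _

/-- The representation of `SU(2)` on the `l`-th Clebsch–Gordan component of `P a ⊗ P b`. -/
abbrev componentRep (a b l : ℕ) : Representation ℂ SU2 (componentSpace a b l) :=
  (component a b l).toRepresentation

end SU2Channels

end

set_option linter.unusedSectionVars false

/-! Write T = Φ₁ ⊗ Φ₂. The projection onto an invariant subspace commutes with a unitary
representation, so each block A ↦ q_l T(A) q_l, with A in End(V_k), is again completely positive and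
covariant. Its dual sends the identity to ∑ Xᵢ* Xᵢ, the sum being over Kraus operators; this
operator commutes with the irreducible representation on V_k, hence by Schur's lemma is a scalar c_l
≥ 0, and the block multiplies traces by c_l. Dividing by c_l gives the channel ψ_l with weight λ_l =
c_l; if c_l = 0 the block vanishes and any covariant channel serves (`exists_eq_smul_channel`). The
weights sum to 1 because T and the pinching preserve the trace.

For the entropy, restricting the inputs to V_k can only raise the minimum, and pinching raises the
entropy because the eigenvalues of the pinched operator are doubly stochastic averages of the
original ones (`entropy_le_entropy_pinching`). `exists_pinching_decomposition` carries this out for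
arbitrary unitary representations.

What is special to SU(2) is the Clebsch–Gordan decomposition. Powers of linear forms act as
reproducing vectors in P_m and give unitarity and irreducibility of `ρ m`. The adjoint of
multiplication, followed by multiplication by powers of x₁y₂ - x₂y₁, embeds the expected
constituents in the tensor product; Schur's lemma makes them orthogonal, and a dimension count shows
that they fill the space. -/

noncomputable section

namespace SU2Channels

/-! ### Kraus decompositions and tensor products of channels -/

section Kraus

variable {H K H₁ H₂ K₁ K₂ : Type*}
  [NormedAddCommGroup H] [InnerProductSpace ℂ H] [FiniteDimensional ℂ H]
  [NormedAddCommGroup K] [InnerProductSpace ℂ K] [FiniteDimensional ℂ K]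
  [NormedAddCommGroup H₁] [InnerProductSpace ℂ H₁] [FiniteDimensional ℂ H₁]
  [NormedAddCommGroup H₂] [InnerProductSpace ℂ H₂] [FiniteDimensional ℂ H₂]
  [NormedAddCommGroup K₁] [InnerProductSpace ℂ K₁] [FiniteDimensional ℂ K₁]
  [NormedAddCommGroup K₂] [InnerProductSpace ℂ K₂] [FiniteDimensional ℂ K₂]

/-- The rank one operator `x y^*` as a linear map. -/
abbrev ketBra (x : K) (y : H) : H →ₗ[ℂ] K := (InnerProductSpace.rankOne ℂ x y).toLinearMap

/-- `V` is a family of Kraus operators for `Φ`. -/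
def IsKraus {ι : Type*} [Fintype ι] (V : ι → H →ₗ[ℂ] K)
    (Φ : Module.End ℂ H →ₗ[ℂ] Module.End ℂ K) : Prop :=
  ∀ A, Φ A = ∑ i, V i ∘ₗ A ∘ₗ LinearMap.adjoint (V i)

theorem eq_sum_ketBra {ι : Type*} [Fintype ι] (b : OrthonormalBasis ι ℂ H) (A : H →ₗ[ℂ] K) :
    A = ∑ j, ketBra (A (b j)) (b j) := by
  ext x
  conv_lhs => rw [← b.sum_repr' x]
  simp

theorem ext_ketBra {ι M : Type*} [Fintype ι] [AddCommMonoid M] [Module ℂ M]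
    (b : OrthonormalBasis ι ℂ H) {F G : Module.End ℂ H →ₗ[ℂ] M}
    (h : ∀ i j, F (ketBra (b i) (b j)) = G (ketBra (b i) (b j))) : F = G := by
  ext A
  have h' : ∀ x j, F (ketBra x (b j)) = G (ketBra x (b j)) := by
    intro x j
    have : ketBra x (b j) = ∑ i, ⟪b i, x⟫_ℂ • ketBra (b i) (b j) := by
      conv_lhs => rw [← b.sum_repr' x]
      ext y
      simp [smul_smul, mul_comm]
    rw [this]
    simp only [map_sum, map_smul, h]
  rw [eq_sum_ketBra b A]
  simp only [map_sum, h']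

theorem conj_ketBra (V : H →ₗ[ℂ] K) (x y : H) :
    V ∘ₗ ketBra x y ∘ₗ LinearMap.adjoint V = ketBra (V x) (V y) := by
  ext z
  simp [LinearMap.adjoint_inner_right]

/-- **Choi's theorem**: a completely positive map has a Kraus decomposition. -/
theorem IsCompletelyPositive.exists_isKraus {Φ : Module.End ℂ H →ₗ[ℂ] Module.End ℂ K}
    (hΦ : IsCompletelyPositive Φ) : ∃ (n : ℕ) (V : Fin n → H →ₗ[ℂ] K), IsKraus V Φ := by
  classical
  let b := stdOrthonormalBasis ℂ H
  let d := Module.finrank ℂ H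
  let e := EuclideanSpace.basisFun (Fin d) ℂ
  -- The unnormalized maximally entangled vector; Φ ⊗ id maps its rank one operator to the Choi
  -- operator C.
  let Ω : H ⊗[ℂ] EuclideanSpace ℂ (Fin d) := ∑ i, b i ⊗ₜ e i
  have hΩ : ketBra Ω Ω =
      ∑ i, ∑ j, TensorProduct.map (ketBra (b i) (b j)) (ketBra (e i) (e j)) := by
    apply TensorProduct.ext'
    intro x y
    simp only [Ω, ContinuousLinearMap.coe_coe, InnerProductSpace.rankOne_apply, sum_inner,
      TensorProduct.inner_tmul, LinearMap.sum_apply, TensorProduct.map_tmul, Finset.smul_sum,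
      Finset.sum_smul, TensorProduct.smul_tmul_smul]
  have hC := hΦ d (ketBra Ω Ω)
    ((ContinuousLinearMap.isPositive_toLinearMap_iff _).mpr
      (InnerProductSpace.isPositive_rankOne_self Ω))
  set C := tensorMap Φ (LinearMap.id : Module.End ℂ (EuclideanSpace ℂ (Fin d)) →ₗ[ℂ] _)
    (ketBra Ω Ω) with hCdef
  have hC' : C = ∑ i, ∑ j, TensorProduct.map (Φ (ketBra (b i) (b j))) (ketBra (e i) (e j)) := by
    rw [hCdef, hΩ]
    simp only [map_sum, tensorMap_map, LinearMap.id_apply]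
  obtain ⟨n, u, hu⟩ := ContinuousLinearMap.isPositive_iff_eq_sum_rankOne.mp
    ((LinearMap.isPositive_toContinuousLinearMap_iff C).mpr hC)
  have hu' : C = ∑ k, ketBra (u k) (u k) := by
    have := congrArg ContinuousLinearMap.toLinearMap hu
    simpa using this
  -- R i contracts the second tensor factor with e i, so it extracts the i-th slice of a vector.
  let R : Fin d → K ⊗[ℂ] EuclideanSpace ℂ (Fin d) →ₗ[ℂ] K := fun i =>
    (TensorProduct.rid ℂ K).toLinearMap ∘ₗ LinearMap.lTensor K (innerSL ℂ (e i)).toLinearMap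
  have hR : ∀ i x y, R i (x ⊗ₜ y) = ⟪e i, y⟫_ℂ • x := by
    intro i x y
    simp [R]
  have hR' : ∀ j v x, ⟪v, x ⊗ₜ[ℂ] e j⟫_ℂ = ⟪R j v, x⟫_ℂ := by
    intro j v x
    induction v with
    | zero => simp
    | add v w hv hw => rw [inner_add_left, hv, hw, map_add, inner_add_left]
    | tmul y z => rw [hR, TensorProduct.inner_tmul, inner_smul_left, inner_conj_symm, mul_comm]
  -- Each u k in K ⊗ ℂᵈ, reshaped into an operator H → K, is a Kraus operator.
  refine ⟨n, fun k => b.toBasis.constr ℂ fun i => R i (u k), ?_⟩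
  let Ψ : Module.End ℂ H →ₗ[ℂ] Module.End ℂ K :=
    { toFun := fun A => ∑ k, (b.toBasis.constr ℂ fun i => R i (u k)) ∘ₗ A ∘ₗ
        LinearMap.adjoint (b.toBasis.constr ℂ fun i => R i (u k))
      map_add' := fun A B => by
        simp only [LinearMap.add_comp, LinearMap.comp_add, Finset.sum_add_distrib]
      map_smul' := fun c A => by
        simp only [LinearMap.smul_comp, LinearMap.comp_smul, Finset.smul_sum, RingHom.id_apply] }
  suffices Φ = Ψ from fun A => LinearMap.congr_fun this A
  refine ext_ketBra b fun i j => ?_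
  change _ = ∑ k : Fin n, _
  have hb : ∀ k i, (b.toBasis.constr ℂ fun i => R i (u k)) (b i) = R i (u k) := by
    intro k i
    have := b.toBasis.constr_basis ℂ (fun i => R i (u k)) i
    rwa [b.coe_toBasis] at this
  simp only [conj_ketBra, hb]
  ext x
  -- The (i, j) block of the Choi operator is Φ applied to a matrix unit.
  have h1 : R i (C (x ⊗ₜ e j)) = Φ (ketBra (b i) (b j)) x := by
    rw [hC']
    simp only [LinearMap.sum_apply, TensorProduct.map_tmul, ContinuousLinearMap.coe_coe,
      InnerProductSpace.rankOne_apply, map_sum, hR, inner_smul_right,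
      orthonormal_iff_ite.mp e.orthonormal]
    rw [Finset.sum_eq_single i, Finset.sum_eq_single j] <;> simp +contextual [eq_comm]
  rw [← h1, hu']
  simp [hR']

theorem IsKraus.isPositive {ι : Type*} [Fintype ι] {V : ι → H →ₗ[ℂ] K}
    {Φ : Module.End ℂ H →ₗ[ℂ] Module.End ℂ K} (h : IsKraus V Φ) {A : Module.End ℂ H}
    (hA : A.IsPositive) : (Φ A).IsPositive := by
  rw [h A]
  exact LinearMap.isPositive_sum _ fun i _ => hA.conj_adjoint (V i)

theorem tensorMap_apply_eq_of_map {Φ₁ : Module.End ℂ H₁ →ₗ[ℂ] Module.End ℂ K₁}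
    {Φ₂ : Module.End ℂ H₂ →ₗ[ℂ] Module.End ℂ K₂}
    {F : Module.End ℂ (H₁ ⊗[ℂ] H₂) →ₗ[ℂ] Module.End ℂ (K₁ ⊗[ℂ] K₂)}
    (h : ∀ A B, F (TensorProduct.map A B) = TensorProduct.map (Φ₁ A) (Φ₂ B)) :
    tensorMap Φ₁ Φ₂ = F := by
  have : (tensorMap Φ₁ Φ₂) ∘ₗ (homTensorHomEquiv ℂ H₁ H₂ H₁ H₂).toLinearMap =
      F ∘ₗ (homTensorHomEquiv ℂ H₁ H₂ H₁ H₂).toLinearMap := by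
    apply TensorProduct.ext'
    intro A B
    have e : (homTensorHomEquiv ℂ H₁ H₂ H₁ H₂) (A ⊗ₜ B) = TensorProduct.map A B := by
      rw [homTensorHomEquiv_apply]; rfl
    simp only [LinearMap.comp_apply, LinearEquiv.coe_coe, e, h, tensorMap_map]
  ext1 X
  obtain ⟨Y, rfl⟩ := (homTensorHomEquiv ℂ H₁ H₂ H₁ H₂).surjective X
  exact LinearMap.congr_fun this Y

/-- The completely positive map with Kraus operators `V`. -/
def krausMap {ι : Type*} [Fintype ι] (V : ι → H →ₗ[ℂ] K) :
    Module.End ℂ H →ₗ[ℂ] Module.End ℂ K where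
  toFun A := ∑ k, V k ∘ₗ A ∘ₗ LinearMap.adjoint (V k)
  map_add' A B := by
    simp only [LinearMap.add_comp, LinearMap.comp_add, Finset.sum_add_distrib]
  map_smul' c A := by
    simp only [LinearMap.smul_comp, LinearMap.comp_smul, Finset.smul_sum, RingHom.id_apply]

theorem isKraus_krausMap {ι : Type*} [Fintype ι] (V : ι → H →ₗ[ℂ] K) : IsKraus V (krausMap V) :=
  fun _ => rfl

theorem IsKraus.tensorMap {ι κ : Type*} [Fintype ι] [Fintype κ] {V : ι → H₁ →ₗ[ℂ] K₁}
    {W : κ → H₂ →ₗ[ℂ] K₂} {Φ₁ : Module.End ℂ H₁ →ₗ[ℂ] Module.End ℂ K₁}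
    {Φ₂ : Module.End ℂ H₂ →ₗ[ℂ] Module.End ℂ K₂} (h₁ : IsKraus V Φ₁) (h₂ : IsKraus W Φ₂) :
    IsKraus (fun p : ι × κ => TensorProduct.map (V p.1) (W p.2)) (tensorMap Φ₁ Φ₂) := by
  rw [tensorMap_apply_eq_of_map
    (F := krausMap fun p : ι × κ => TensorProduct.map (V p.1) (W p.2))]
  · exact isKraus_krausMap _
  · intro A B
    rw [h₁ A, h₂ B, isKraus_krausMap _ _, Fintype.sum_prod_type]
    apply TensorProduct.ext'
    intro x y
    simp [TensorProduct.adjoint_map, TensorProduct.sum_tmul, TensorProduct.tmul_sum,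
      LinearMap.sum_apply]
    exact Finset.sum_comm

theorem isKraus_id : IsKraus (fun _ : Unit => (LinearMap.id : H →ₗ[ℂ] H))
    (LinearMap.id : Module.End ℂ H →ₗ[ℂ] Module.End ℂ H) := by
  intro A
  simp

/-- The identity has a single Kraus operator, so Φ ⊗ id has a Kraus form too and therefore preserves
positivity. -/
theorem IsKraus.isCompletelyPositive {ι : Type*} [Fintype ι] {V : ι → H →ₗ[ℂ] K}
    {Φ : Module.End ℂ H →ₗ[ℂ] Module.End ℂ K} (h : IsKraus V Φ) : IsCompletelyPositive Φ :=
  fun _ _ hA => (h.tensorMap isKraus_id).isPositive hA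

/-- Cyclicity of the trace. The effect on traces is thus encoded in the one operator ∑ Vᵢ* Vᵢ, to
which Schur's lemma is applied later. -/
theorem IsKraus.trace_eq {ι : Type*} [Fintype ι] {V : ι → H →ₗ[ℂ] K}
    {Φ : Module.End ℂ H →ₗ[ℂ] Module.End ℂ K} (h : IsKraus V Φ) (A : Module.End ℂ H) :
    LinearMap.trace ℂ K (Φ A) =
      LinearMap.trace ℂ H (A ∘ₗ ∑ i, LinearMap.adjoint (V i) ∘ₗ V i) := by
  have h1 : A ∘ₗ ∑ i, LinearMap.adjoint (V i) ∘ₗ V i =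
      ∑ i, (A ∘ₗ LinearMap.adjoint (V i)) ∘ₗ V i := by
    ext x; simp [LinearMap.sum_apply]
  rw [h A, h1, map_sum, map_sum]
  exact Finset.sum_congr rfl fun i _ => LinearMap.trace_comp_comm' _ _

theorem trace_tensorMap {Φ₁ : Module.End ℂ H₁ →ₗ[ℂ] Module.End ℂ K₁}
    {Φ₂ : Module.End ℂ H₂ →ₗ[ℂ] Module.End ℂ K₂}
    (h₁ : ∀ A, LinearMap.trace ℂ K₁ (Φ₁ A) = LinearMap.trace ℂ H₁ A)
    (h₂ : ∀ A, LinearMap.trace ℂ K₂ (Φ₂ A) = LinearMap.trace ℂ H₂ A)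
    (A : Module.End ℂ (H₁ ⊗[ℂ] H₂)) :
    LinearMap.trace ℂ _ (tensorMap Φ₁ Φ₂ A) = LinearMap.trace ℂ _ A := by
  obtain ⟨Y, rfl⟩ := (homTensorHomEquiv ℂ H₁ H₂ H₁ H₂).surjective A
  induction Y with
  | zero => simp
  | add x y hx hy => simp only [map_add, hx, hy]
  | tmul A B =>
    have e : (homTensorHomEquiv ℂ H₁ H₂ H₁ H₂) (A ⊗ₜ B) = TensorProduct.map A B := by
      rw [homTensorHomEquiv_apply]; rfl
    rw [e, tensorMap_map, LinearMap.trace_tensorProduct', LinearMap.trace_tensorProduct', h₁, h₂]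

theorem tensorMap_covariant {G : Type*} [Group G] {π₁ : Representation ℂ G H₁}
    {π₂ : Representation ℂ G H₂} {σ₁ : Representation ℂ G K₁} {σ₂ : Representation ℂ G K₂}
    {Φ₁ : Module.End ℂ H₁ →ₗ[ℂ] Module.End ℂ K₁} {Φ₂ : Module.End ℂ H₂ →ₗ[ℂ] Module.End ℂ K₂}
    (h₁ : IsCovariantChannel π₁ σ₁ Φ₁) (h₂ : IsCovariantChannel π₂ σ₂ Φ₂) (g : G)
    (A : Module.End ℂ (H₁ ⊗[ℂ] H₂)) :
    tensorMap Φ₁ Φ₂ ((π₁.tprod π₂) g ∘ₗ A ∘ₗ LinearMap.adjoint ((π₁.tprod π₂) g)) =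
      (σ₁.tprod σ₂) g ∘ₗ tensorMap Φ₁ Φ₂ A ∘ₗ LinearMap.adjoint ((σ₁.tprod σ₂) g) := by
  obtain ⟨Y, rfl⟩ := (homTensorHomEquiv ℂ H₁ H₂ H₁ H₂).surjective A
  induction Y with
  | zero => simp
  | add x y hx hy => simp only [map_add, LinearMap.add_comp, LinearMap.comp_add, hx, hy]
  | tmul A B =>
    have e : (homTensorHomEquiv ℂ H₁ H₂ H₁ H₂) (A ⊗ₜ B) = TensorProduct.map A B := by
      rw [homTensorHomEquiv_apply]; rfl
    rw [e, tensorMap_map, Representation.tprod_apply, Representation.tprod_apply,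
      TensorProduct.adjoint_map, TensorProduct.adjoint_map, ← TensorProduct.map_comp,
      ← TensorProduct.map_comp, tensorMap_map, h₁.covariant, h₂.covariant,
      TensorProduct.map_comp, TensorProduct.map_comp]

end Kraus

/-! ### Von Neumann entropy and pinching -/

section Entropy

variable {H : Type*} [NormedAddCommGroup H] [InnerProductSpace ℂ H] [FiniteDimensional ℂ H]

theorem entropy_eq_sum_negMulLog {A : Module.End ℂ H} (hA : A.IsSymmetric) :
    entropy A = (∑ i, Real.negMulLog (hA.eigenvalues rfl i)) / Real.log 2 := by
  rw [entropy, dif_pos hA, Finset.sum_div, ← Finset.sum_neg_distrib]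
  refine Finset.sum_congr rfl fun i _ => ?_
  rw [Real.negMulLog, Real.logb]
  ring

/-- The eigenvalues lie in [0, 1]. This is the lower bound that makes the infimum defining
`minOutputEntropy` meaningful. -/
theorem entropy_nonneg {A : Module.End ℂ H} (hA : A.IsPositive)
    (htr : LinearMap.trace ℂ H A = 1) : 0 ≤ entropy A := by
  rw [entropy_eq_sum_negMulLog hA.isSymmetric]
  have hsum : ∑ i, hA.isSymmetric.eigenvalues rfl i = 1 := by
    rw [← hA.isSymmetric.re_trace_eq_sum_eigenvalues rfl, htr]
    simp
  refine div_nonneg (Finset.sum_nonneg fun i _ => ?_) (Real.log_nonneg (by norm_num))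
  refine Real.negMulLog_nonneg (hA.nonneg_eigenvalues rfl i) ?_
  rw [← hsum]
  exact Finset.single_le_sum (f := fun i => hA.isSymmetric.eigenvalues rfl i)
    (fun j _ => hA.nonneg_eigenvalues rfl j) (Finset.mem_univ i)

theorem re_inner_apply_self_eq_sum {A : Module.End ℂ H} (hA : A.IsSymmetric) (x : H) :
    (⟪x, A x⟫_ℂ).re =
      ∑ j, ‖⟪hA.eigenvectorBasis rfl j, x⟫_ℂ‖ ^ 2 * hA.eigenvalues rfl j := by
  rw [← (hA.eigenvectorBasis rfl).sum_inner_mul_inner, Complex.re_sum]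
  refine Finset.sum_congr rfl fun j _ => ?_
  rw [← hA, hA.apply_eigenvectorBasis, inner_smul_left, ← inner_conj_symm x, mul_left_comm,
    ← Complex.normSq_eq_conj_mul_self, Complex.normSq_eq_norm_sq]
  simp [mul_comm, -Complex.ofReal_pow]

theorem adjoint_starProjection (W : Submodule ℂ H) :
    LinearMap.adjoint W.starProjection.toLinearMap = W.starProjection.toLinearMap := by
  symm
  rw [LinearMap.eq_adjoint_iff]
  exact fun x y => W.inner_starProjection_left_eq_right x y

variable {ι : Type*} [Fintype ι] {W : ι → Submodule ℂ H}

theorem isKraus_pinching (W : ι → Submodule ℂ H) :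
    IsKraus (fun l => (W l).starProjection.toLinearMap) (pinching W) := by
  intro A
  simp only [adjoint_starProjection]
  rfl

/-- Pythagoras, from a resolution of the identity by self-adjoint idempotents; their mutual
orthogonality need not be assumed separately. -/
theorem sum_norm_sq_starProjection (hW : ∀ v, ∑ l, (W l).starProjection v = v) (v : H) :
    ∑ l, ‖(W l).starProjection v‖ ^ 2 = ‖v‖ ^ 2 := by
  have h : ∀ l, ‖(W l).starProjection v‖ ^ 2 = (⟪v, (W l).starProjection v⟫_ℂ).re := by
    intro l
    have h1 := (W l).inner_starProjection_left_eq_right v ((W l).starProjection v)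
    have h2 : (W l).starProjection ((W l).starProjection v) = (W l).starProjection v :=
      (W l).starProjection_eq_self_iff.mpr ((W l).starProjection_apply_mem v)
    rw [h2] at h1
    rw [← h1]
    exact (inner_self_eq_norm_sq (𝕜 := ℂ) _).symm
  simp only [h]
  rw [← Complex.re_sum, ← inner_sum, hW]
  exact inner_self_eq_norm_sq (𝕜 := ℂ) _

theorem trace_pinching (hW : ∀ v, ∑ l, (W l).starProjection v = v) (A : Module.End ℂ H) :
    LinearMap.trace ℂ H (pinching W A) = LinearMap.trace ℂ H A := by
  rw [(isKraus_pinching W).trace_eq A]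
  congr 1
  ext x
  have h2 : ∀ l y, (W l).starProjection ((W l).starProjection y) = (W l).starProjection y :=
    fun l y => (W l).starProjection_eq_self_iff.mpr ((W l).starProjection_apply_mem y)
  simp [adjoint_starProjection, h2, hW]

/-- Pinching does not decrease the entropy. -/
theorem entropy_le_entropy_pinching (hW : ∀ v, ∑ l, (W l).starProjection v = v)
    {A : Module.End ℂ H} (hA : A.IsPositive) : entropy A ≤ entropy (pinching W A) := by
  have hE := (isKraus_pinching W).isPositive hA
  rw [entropy_eq_sum_negMulLog hA.isSymmetric, entropy_eq_sum_negMulLog hE.isSymmetric]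
  refine div_le_div_of_nonneg_right ?_ (Real.log_nonneg (by norm_num))
  set e := hE.isSymmetric.eigenvectorBasis rfl with he
  set f := hA.isSymmetric.eigenvectorBasis rfl with hf
  set μ := hE.isSymmetric.eigenvalues rfl with hμ
  set p := hA.isSymmetric.eigenvalues rfl with hp
  -- The matrix expressing the eigenvalues of the pinched operator through those of A. It is doubly
  -- stochastic: its row and column sums are the squared norms of the basis vectors e i and f j.
  let D := fun i j => ∑ l, ‖⟪f j, (W l).starProjection (e i)⟫_ℂ‖ ^ 2
  have hD0 : ∀ i j, 0 ≤ D i j := fun i j => Finset.sum_nonneg fun l _ => by positivity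
  have hDrow : ∀ i, ∑ j, D i j = 1 := by
    intro i
    rw [Finset.sum_comm]
    simp only [f.sum_sq_norm_inner_right, sum_norm_sq_starProjection hW, e.norm_eq_one, one_pow]
  have hDcol : ∀ j, ∑ i, D i j = 1 := by
    intro j
    rw [Finset.sum_comm]
    simp only [← Submodule.inner_starProjection_left_eq_right, e.sum_sq_norm_inner_left,
      sum_norm_sq_starProjection hW, f.norm_eq_one, one_pow]
  have hμD : ∀ i, μ i = ∑ j, D i j * p j := by
    intro i
    have h1 : (⟪e i, pinching W A (e i)⟫_ℂ).re = μ i := by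
      rw [he, hE.isSymmetric.apply_eigenvectorBasis, inner_smul_right]
      simp [hμ]
    have h2 : ⟪e i, pinching W A (e i)⟫_ℂ =
        ∑ l, ⟪(W l).starProjection (e i), A ((W l).starProjection (e i))⟫_ℂ := by
      rw [(isKraus_pinching W) A]
      simp only [adjoint_starProjection, LinearMap.sum_apply, inner_sum, LinearMap.comp_apply,
        ContinuousLinearMap.coe_coe, Submodule.inner_starProjection_left_eq_right]
    rw [← h1, h2, Complex.re_sum]
    simp only [re_inner_apply_self_eq_sum hA.isSymmetric, D, Finset.sum_mul]
    rw [Finset.sum_comm]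
  calc ∑ j, Real.negMulLog (p j) = ∑ i, ∑ j, D i j * Real.negMulLog (p j) := by
        rw [Finset.sum_comm]
        simp only [← Finset.sum_mul, hDcol, one_mul]
    _ ≤ ∑ i, Real.negMulLog (μ i) := by
        refine Finset.sum_le_sum fun i _ => ?_
        rw [hμD i]
        -- Jensen's inequality in each row; the column sums were used to spread out the left-hand
        -- side.
        exact Real.concaveOn_negMulLog.le_map_sum (fun j _ => hD0 i j) (hDrow i)
          fun j _ => hA.nonneg_eigenvalues rfl j

end Entropy

/-! ### Schur's lemma and covariant maps out of an irreducible representation -/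

section Schur

variable {H K : Type*}
  [NormedAddCommGroup H] [InnerProductSpace ℂ H] [FiniteDimensional ℂ H]
  [NormedAddCommGroup K] [InnerProductSpace ℂ K] [FiniteDimensional ℂ K]
  {G : Type*} [Group G]

/-- A representation by unitary operators. -/
def IsUnitaryRep (π : Representation ℂ G H) : Prop :=
  ∀ g, LinearMap.adjoint (π g) = π g⁻¹

theorem rep_comp_inv (π : Representation ℂ G H) (g : G) : π g ∘ₗ π g⁻¹ = LinearMap.id := by
  rw [← Module.End.mul_eq_comp, ← map_mul, mul_inv_cancel, map_one]
  rfl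

theorem rep_inv_comp (π : Representation ℂ G H) (g : G) : π g⁻¹ ∘ₗ π g = LinearMap.id := by
  rw [← Module.End.mul_eq_comp, ← map_mul, inv_mul_cancel, map_one]
  rfl

theorem IsUnitaryRep.trace_conj {π : Representation ℂ G H} (hπ : IsUnitaryRep π) (g : G)
    (A : Module.End ℂ H) :
    LinearMap.trace ℂ H (π g ∘ₗ A ∘ₗ LinearMap.adjoint (π g)) = LinearMap.trace ℂ H A := by
  rw [hπ g, LinearMap.trace_comp_comm', LinearMap.comp_assoc, rep_inv_comp, LinearMap.comp_id]

/-- **Schur's lemma**: an operator commuting with an irreducible representation is a scalar. -/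
theorem exists_eq_smul_id_of_commute (π : Representation ℂ G H) (hirr : π.IsIrreducible)
    {B : Module.End ℂ H} (hB : ∀ g, B ∘ₗ π g = π g ∘ₗ B) : ∃ c : ℂ, B = c • LinearMap.id := by
  have := hirr
  obtain ⟨c, hc⟩ :=
    (Representation.IsIrreducible.algebraMap_intertwiningMap_bijective_of_isAlgClosed
      (ρ := π)).2 (⟨B, hB⟩ : Representation.IntertwiningMap π π)
  refine ⟨c, ?_⟩
  have := congrArg (fun f => f.toLinearMap) hc
  exact this.symm

/-- Irreducibility includes being nonzero. This supplies unit vectors and an invertible dimension.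
-/
theorem nontrivial_of_isIrreducible (π : Representation ℂ G H) (hirr : π.IsIrreducible) :
    Nontrivial H := by
  by_contra h
  rw [not_nontrivial_iff_subsingleton] at h
  have := hirr
  refine bot_ne_top (α := Subrepresentation π) (Subrepresentation.toSubmodule_injective ?_)
  exact Subsingleton.elim _ _

/-- The completely depolarizing channel `A ↦ tr(A) / dim K • 1`. -/
def depolarizing (H K : Type*)
    [NormedAddCommGroup H] [InnerProductSpace ℂ H] [FiniteDimensional ℂ H]
    [NormedAddCommGroup K] [InnerProductSpace ℂ K] [FiniteDimensional ℂ K] :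
    Module.End ℂ H →ₗ[ℂ] Module.End ℂ K :=
  (LinearMap.trace ℂ H).smulRight ((Module.finrank ℂ K : ℂ)⁻¹ • LinearMap.id)

/-- The matrix units between two orthonormal bases, each scaled by (dim K)^(-1/2), average A to its
trace times the normalized identity. -/
theorem isKraus_depolarizing :
    IsKraus (fun p : Fin (Module.finrank ℂ K) × Fin (Module.finrank ℂ H) =>
      ((Real.sqrt (Module.finrank ℂ K : ℝ)⁻¹ : ℝ) : ℂ) •
        ketBra (stdOrthonormalBasis ℂ K p.1) (stdOrthonormalBasis ℂ H p.2))
      (depolarizing H K) := by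
  intro A
  have hs : ((Real.sqrt (Module.finrank ℂ K : ℝ)⁻¹ : ℝ) : ℂ) *
      ((Real.sqrt (Module.finrank ℂ K : ℝ)⁻¹ : ℝ) : ℂ) = (Module.finrank ℂ K : ℂ)⁻¹ := by
    rw [← Complex.ofReal_mul, Real.mul_self_sqrt (by positivity)]
    simp
  have hadj : ∀ (x : K) (y : H), LinearMap.adjoint (ketBra x y) = ketBra y x := by
    intro x y
    symm
    rw [LinearMap.eq_adjoint_iff]
    intro u v
    simp [inner_smul_left, inner_smul_right, mul_comm]
  ext z
  rw [Fintype.sum_prod_type]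
  simp only [map_smulₛₗ, hadj, Complex.conj_ofReal, LinearMap.sum_apply, LinearMap.comp_apply,
    LinearMap.smul_apply, ContinuousLinearMap.coe_coe, InnerProductSpace.rankOne_apply, depolarizing,
    LinearMap.smulRight_apply,
    LinearMap.trace_eq_sum_inner A (stdOrthonormalBasis ℂ H), LinearMap.id_apply, smul_smul]
  conv_lhs => rw [← (stdOrthonormalBasis ℂ K).sum_repr' z]
  simp only [Finset.smul_sum, Finset.sum_smul, Finset.sum_mul, smul_smul]
  refine Finset.sum_congr rfl fun i _ => Finset.sum_congr rfl fun j _ => ?_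
  congr 1
  rw [← hs]
  simp only [RingHom.id_apply]
  ring

theorem isCovariantChannel_depolarizing {π : Representation ℂ G H} {σ : Representation ℂ G K}
    (hπ : IsUnitaryRep π) (hσ : IsUnitaryRep σ) [Nontrivial K] :
    IsCovariantChannel π σ (depolarizing H K) := by
  have hd : (Module.finrank ℂ K : ℂ) ≠ 0 := by
    exact_mod_cast (Module.finrank_pos (R := ℂ) (M := K)).ne'
  refine ⟨⟨isKraus_depolarizing.isCompletelyPositive, fun A => ?_⟩, fun g A => ?_⟩
  · simp [depolarizing, hd]
  · simp only [depolarizing, LinearMap.smulRight_apply, hπ.trace_conj, LinearMap.smul_comp,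
      LinearMap.comp_smul, LinearMap.id_comp, hσ g, rep_comp_inv]

open scoped ComplexOrder in
/-- A covariant completely positive map out of an irreducible representation is a nonnegative
multiple of a covariant channel. -/
theorem exists_eq_smul_channel {π : Representation ℂ G H} {σ : Representation ℂ G K}
    (hπ : IsUnitaryRep π) (hσ : IsUnitaryRep σ) (hirr : π.IsIrreducible) [Nontrivial K]
    {ι : Type*} [Fintype ι] {V : ι → H →ₗ[ℂ] K} {Φ : Module.End ℂ H →ₗ[ℂ] Module.End ℂ K}
    (hV : IsKraus V Φ)
    (hcov : ∀ g A, Φ (π g ∘ₗ A ∘ₗ LinearMap.adjoint (π g)) =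
      σ g ∘ₗ Φ A ∘ₗ LinearMap.adjoint (σ g)) :
    ∃ (c : ℝ) (ψ : Module.End ℂ H →ₗ[ℂ] Module.End ℂ K),
      0 ≤ c ∧ IsCovariantChannel π σ ψ ∧ Φ = (c : ℂ) • ψ := by
  -- B is the dual of Φ applied to the identity. Covariance of Φ and invariance of the trace make
  -- its sesquilinear form invariant.
  set B : Module.End ℂ H := ∑ i, LinearMap.adjoint (V i) ∘ₗ V i with hBdef
  have hBpos : B.IsPositive :=
    LinearMap.isPositive_sum _ fun i _ => LinearMap.isPositive_adjoint_comp_self (V i)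
  have htr : ∀ x y, LinearMap.trace ℂ K (Φ (ketBra x y)) = ⟪y, B x⟫_ℂ := by
    intro x y
    rw [hV.trace_eq, ← hBdef, LinearMap.trace_comp_comm']
    have : B ∘ₗ ketBra x y = ketBra (B x) y := by ext z; simp
    rw [this, InnerProductSpace.trace_rankOne]
  have hinv : ∀ g x y, ⟪π g y, B (π g x)⟫_ℂ = ⟪y, B x⟫_ℂ := by
    intro g x y
    rw [← htr, ← htr, ← conj_ketBra, hcov, hσ.trace_conj]
  have hcomm : ∀ g, B ∘ₗ π g = π g ∘ₗ B := by
    intro g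
    ext x
    refine ext_inner_left ℂ fun y => ?_
    have h := hinv g x (π g⁻¹ y)
    have h1 : π g (π g⁻¹ y) = y := LinearMap.congr_fun (rep_comp_inv π g) y
    rw [h1] at h
    rw [LinearMap.comp_apply, h, LinearMap.comp_apply, ← hπ g, LinearMap.adjoint_inner_left]
  obtain ⟨z, hz⟩ := exists_eq_smul_id_of_commute π hirr hcomm
  have := nontrivial_of_isIrreducible π hirr
  obtain ⟨w, hw⟩ := exists_ne (0 : H)
  have hz0 : 0 ≤ z := by
    have h := hBpos
    rw [hz] at h
    refine (LinearMap.isPositive_id.isPositive_smul_iff ?_).mp h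
    intro h0
    exact hw (by simpa using LinearMap.congr_fun h0 w)
  obtain ⟨c, hc0, rfl⟩ : ∃ c : ℝ, 0 ≤ c ∧ (c : ℂ) = z :=
    ⟨z.re, (Complex.nonneg_iff.mp hz0).1,
      Complex.ext (by simp) (by simpa using (Complex.nonneg_iff.mp hz0).2)⟩
  -- When c = 0 no normalization is possible, but then every Kraus operator vanishes and the
  -- depolarizing channel fills the gap.
  rcases hc0.eq_or_lt with rfl | hcpos
  · refine ⟨0, depolarizing H K, le_rfl, isCovariantChannel_depolarizing hπ hσ, ?_⟩
    have hVz : ∀ i, V i = 0 := by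
      have h0 : ∀ x, ∑ i, ‖V i x‖ ^ 2 = 0 := by
        intro x
        have h1 : ⟪x, B x⟫_ℂ = ∑ i, ((‖V i x‖ ^ 2 : ℝ) : ℂ) := by
          simp only [hBdef, LinearMap.sum_apply, inner_sum, LinearMap.comp_apply,
            LinearMap.adjoint_inner_right, inner_self_eq_norm_sq_to_K]
          simp
        rw [hz] at h1
        rw [← Complex.ofReal_sum] at h1
        have h2 := congrArg Complex.re h1
        rw [Complex.ofReal_re] at h2
        rw [← h2]
        simp
      intro i
      ext x
      have := (Finset.sum_eq_zero_iff_of_nonneg fun i _ => by positivity).mp (h0 x) i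
        (Finset.mem_univ i)
      simpa using this
    ext A : 1
    rw [hV A]
    simp [hVz]
  · have hcC : (c : ℂ) ≠ 0 := by exact_mod_cast hcpos.ne'
    refine ⟨c, (c : ℂ)⁻¹ • Φ, hc0, ⟨⟨?_, ?_⟩, ?_⟩, by rw [smul_inv_smul₀ hcC]⟩
    · refine IsKraus.isCompletelyPositive (V := fun i => ((Real.sqrt c⁻¹ : ℝ) : ℂ) • V i) ?_
      intro A
      have hs : ((Real.sqrt c⁻¹ : ℝ) : ℂ) * ((Real.sqrt c⁻¹ : ℝ) : ℂ) = (c : ℂ)⁻¹ := by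
        rw [← Complex.ofReal_mul, Real.mul_self_sqrt (by positivity)]
        simp
      rw [LinearMap.smul_apply, hV A, Finset.smul_sum]
      refine Finset.sum_congr rfl fun i _ => ?_
      rw [map_smulₛₗ, Complex.conj_ofReal, LinearMap.comp_smul, LinearMap.comp_smul,
        LinearMap.smul_comp, smul_smul, hs]
    · intro A
      rw [LinearMap.smul_apply, map_smul, hV.trace_eq, ← hBdef, hz, LinearMap.comp_smul, map_smul,
        LinearMap.comp_id, inv_smul_smul₀ hcC]
    · intro g A
      simp only [LinearMap.smul_apply, hcov, LinearMap.smul_comp, LinearMap.comp_smul]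

end Schur

/-! ### Compression to subrepresentations and the abstract form of the theorem -/

section Subrepresentations

variable {H K U L : Type*}
  [NormedAddCommGroup H] [InnerProductSpace ℂ H] [FiniteDimensional ℂ H]
  [NormedAddCommGroup K] [InnerProductSpace ℂ K] [FiniteDimensional ℂ K]
  [NormedAddCommGroup U] [InnerProductSpace ℂ U] [FiniteDimensional ℂ U]
  [NormedAddCommGroup L] [InnerProductSpace ℂ L] [FiniteDimensional ℂ L]
  {G : Type*} [Group G]

theorem IsUnitaryRep.toRepresentation {π : Representation ℂ G H} (hπ : IsUnitaryRep π)
    (W : Subrepresentation π) : IsUnitaryRep W.toRepresentation := by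
  intro g
  symm
  rw [LinearMap.eq_adjoint_iff]
  intro x y
  change ⟪π g⁻¹ (x : H), (y : H)⟫_ℂ = ⟪(x : H), π g (y : H)⟫_ℂ
  rw [← hπ g, LinearMap.adjoint_inner_left]

theorem adjoint_subtype (W : Submodule ℂ H) :
    LinearMap.adjoint W.subtype = W.orthogonalProjectionOnto.toLinearMap := by
  symm
  rw [LinearMap.eq_adjoint_iff]
  intro x y
  simp

/-- Pairing with y in W, unitarity moves g to g⁻¹ on y, which stays in W, where the projection is
invisible. -/
theorem IsUnitaryRep.orthogonalProjectionOnto_rep {π : Representation ℂ G H} (hπ : IsUnitaryRep π)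
    (W : Subrepresentation π) (g : G) (x : H) :
    W.toSubmodule.orthogonalProjectionOnto (π g x) =
      W.toRepresentation g (W.toSubmodule.orthogonalProjectionOnto x) := by
  refine ext_inner_left ℂ fun y => ?_
  have h1 : π g = LinearMap.adjoint (π g⁻¹) := by rw [hπ, inv_inv]
  have h2 : W.toRepresentation g = LinearMap.adjoint (W.toRepresentation g⁻¹) := by
    rw [hπ.toRepresentation W, inv_inv]
  rw [h2, LinearMap.adjoint_inner_right, Submodule.inner_orthogonalProjectionOnto_eq_of_mem_left,
    Submodule.inner_orthogonalProjectionOnto_eq_of_mem_left, h1, LinearMap.adjoint_inner_right]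
  rfl

theorem IsUnitaryRep.inclEnd_conj {π : Representation ℂ G H} (hπ : IsUnitaryRep π)
    (W : Subrepresentation π) (g : G) (A : Module.End ℂ W.toSubmodule) :
    inclEnd W.toSubmodule
        (W.toRepresentation g ∘ₗ A ∘ₗ LinearMap.adjoint (W.toRepresentation g)) =
      π g ∘ₗ inclEnd W.toSubmodule A ∘ₗ LinearMap.adjoint (π g) := by
  rw [hπ.toRepresentation W, hπ]
  ext x
  change ((W.toRepresentation g (A (W.toRepresentation g⁻¹ _)) : W.toSubmodule) : H) =
    π g (A (W.toSubmodule.orthogonalProjectionOnto (π g⁻¹ x)) : W.toSubmodule)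
  rw [hπ.orthogonalProjectionOnto_rep W]
  rfl

theorem inclEnd_pureState (V : Submodule ℂ H) (w : V) :
    inclEnd V (pureState w) = pureState (w : H) := by
  ext x
  simp [inclEnd, pureState]

/-- The compression `A ↦ q T(A) q` of a map `T` to subspaces `V` and `W`. -/
def compress (T : Module.End ℂ U →ₗ[ℂ] Module.End ℂ L) (V : Submodule ℂ U) (W : Submodule ℂ L) :
    Module.End ℂ V →ₗ[ℂ] Module.End ℂ W where
  toFun A := W.orthogonalProjectionOnto.toLinearMap ∘ₗ T (inclEnd V A) ∘ₗ W.subtype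
  map_add' A B := by simp only [map_add, LinearMap.add_comp, LinearMap.comp_add]
  map_smul' c A := by
    simp only [map_smul, LinearMap.smul_comp, LinearMap.comp_smul, RingHom.id_apply]

theorem IsKraus.compress {ι : Type*} [Fintype ι] {X : ι → U →ₗ[ℂ] L}
    {T : Module.End ℂ U →ₗ[ℂ] Module.End ℂ L} (h : IsKraus X T) (V : Submodule ℂ U)
    (W : Submodule ℂ L) :
    IsKraus (fun i => W.orthogonalProjectionOnto.toLinearMap ∘ₗ X i ∘ₗ V.subtype)
      (compress T V W) := by
  intro A
  have hadj : ∀ i, LinearMap.adjoint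
      (W.orthogonalProjectionOnto.toLinearMap ∘ₗ X i ∘ₗ V.subtype) =
      (V.orthogonalProjectionOnto.toLinearMap ∘ₗ LinearMap.adjoint (X i)) ∘ₗ W.subtype := by
    intro i
    rw [LinearMap.adjoint_comp, LinearMap.adjoint_comp, adjoint_subtype, ← adjoint_subtype W,
      LinearMap.adjoint_adjoint]
  ext1 x
  simp only [SU2Channels.compress, LinearMap.coe_mk, AddHom.coe_mk, h (inclEnd V A), hadj,
    LinearMap.comp_apply, LinearMap.sum_apply, ContinuousLinearMap.coe_coe, map_sum]
  rfl

/-- Identifies a compressed block, extended by zero, with one summand of the pinching. -/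
theorem inclEnd_compress (T : Module.End ℂ U →ₗ[ℂ] Module.End ℂ L) (V : Submodule ℂ U)
    (W : Submodule ℂ L) (A : Module.End ℂ V) :
    inclEnd W (compress T V W A) =
      W.starProjection.toLinearMap ∘ₗ T (inclEnd V A) ∘ₗ W.starProjection.toLinearMap :=
  rfl

theorem compress_conj {π : Representation ℂ G U} {σ : Representation ℂ G L}
    (hπ : IsUnitaryRep π) (hσ : IsUnitaryRep σ) {T : Module.End ℂ U →ₗ[ℂ] Module.End ℂ L}
    (hT : ∀ g A, T (π g ∘ₗ A ∘ₗ LinearMap.adjoint (π g)) =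
      σ g ∘ₗ T A ∘ₗ LinearMap.adjoint (σ g))
    (V : Subrepresentation π) (W : Subrepresentation σ) (g : G)
    (A : Module.End ℂ V.toSubmodule) :
    compress T V.toSubmodule W.toSubmodule
        (V.toRepresentation g ∘ₗ A ∘ₗ LinearMap.adjoint (V.toRepresentation g)) =
      W.toRepresentation g ∘ₗ compress T V.toSubmodule W.toSubmodule A ∘ₗ
        LinearMap.adjoint (W.toRepresentation g) := by
  ext1 x
  change W.toSubmodule.orthogonalProjectionOnto
    (T (inclEnd V.toSubmodule _) (x : L)) = _
  rw [hπ.inclEnd_conj, hT, LinearMap.comp_apply, hσ.orthogonalProjectionOnto_rep, hσ,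
    hσ.toRepresentation W]
  rfl

theorem trace_inclEnd (W : Submodule ℂ H) (A : Module.End ℂ W) :
    LinearMap.trace ℂ H (inclEnd W A) = LinearMap.trace ℂ W A := by
  change LinearMap.trace ℂ H (W.subtype ∘ₗ A ∘ₗ W.orthogonalProjectionOnto.toLinearMap) = _
  rw [LinearMap.trace_comp_comm', LinearMap.comp_assoc]
  congr 1
  ext x
  simp

theorem trace_pureState (w : H) (hw : ‖w‖ = 1) : LinearMap.trace ℂ H (pureState w) = 1 := by
  rw [pureState, InnerProductSpace.trace_rankOne, inner_self_eq_norm_sq_to_K, hw]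
  simp

theorem isPositive_pureState (w : H) : (pureState w).IsPositive :=
  (ContinuousLinearMap.isPositive_toLinearMap_iff _).mpr
    (InnerProductSpace.isPositive_rankOne_self w)

/-- Restricting a covariant channel to an irreducible subrepresentation and pinching along a
decomposition into irreducible subrepresentations gives a convex combination of irreducibly
covariant channels, whose minimal output entropy is at least that of the channel. -/
theorem exists_pinching_decomposition {π : Representation ℂ G U} {σ : Representation ℂ G L}
    (hπ : IsUnitaryRep π) (hσ : IsUnitaryRep σ) {κ : Type*} [Fintype κ] {X : κ → U →ₗ[ℂ] L}
    {T : Module.End ℂ U →ₗ[ℂ] Module.End ℂ L} (hX : IsKraus X T)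
    (htr : ∀ A, LinearMap.trace ℂ L (T A) = LinearMap.trace ℂ U A)
    (hT : ∀ g A, T (π g ∘ₗ A ∘ₗ LinearMap.adjoint (π g)) =
      σ g ∘ₗ T A ∘ₗ LinearMap.adjoint (σ g))
    (V : Subrepresentation π) (hV : V.toRepresentation.IsIrreducible)
    {ι : Type*} [Fintype ι] (W : ι → Subrepresentation σ)
    (hW : ∀ l, (W l).toRepresentation.IsIrreducible)
    (hsum : ∀ v, ∑ l, (W l).toSubmodule.starProjection v = v) :
    ∃ (ψ : ∀ l, Module.End ℂ V.toSubmodule →ₗ[ℂ] Module.End ℂ (W l).toSubmodule) (lam : ι → ℝ),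
      (∀ l, IsIrreduciblyCovariantChannel V.toRepresentation (W l).toRepresentation (ψ l)) ∧
      (∀ l, 0 ≤ lam l) ∧ ∑ l, lam l = 1 ∧
      ∑ l, (lam l : ℂ) • (inclEnd (W l).toSubmodule ∘ₗ ψ l) =
        pinching (fun l => (W l).toSubmodule) ∘ₗ T ∘ₗ inclEnd V.toSubmodule ∧
      minOutputEntropy T ≤
        minOutputEntropy (∑ l, (lam l : ℂ) • (inclEnd (W l).toSubmodule ∘ₗ ψ l)) := by
  have hex : ∀ l, ∃ (c : ℝ) (ψ : Module.End ℂ V.toSubmodule →ₗ[ℂ] Module.End ℂ (W l).toSubmodule),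
      0 ≤ c ∧ IsCovariantChannel V.toRepresentation (W l).toRepresentation ψ ∧
        compress T V.toSubmodule (W l).toSubmodule = (c : ℂ) • ψ := by
    intro l
    have := nontrivial_of_isIrreducible _ (hW l)
    exact exists_eq_smul_channel (hπ.toRepresentation V) (hσ.toRepresentation (W l)) hV
      (hX.compress V.toSubmodule (W l).toSubmodule) (compress_conj hπ hσ hT V (W l))
  choose lam ψ hlam hψ hc using hex
  have hsumEq : ∑ l, (lam l : ℂ) • (inclEnd (W l).toSubmodule ∘ₗ ψ l) =
      pinching (fun l => (W l).toSubmodule) ∘ₗ T ∘ₗ inclEnd V.toSubmodule := by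
    ext1 A
    rw [LinearMap.sum_apply]
    refine Finset.sum_congr rfl fun l _ => ?_
    rw [← LinearMap.comp_smul, ← hc]
    exact inclEnd_compress T _ _ A
  have := nontrivial_of_isIrreducible _ hV
  obtain ⟨w₀, hw₀⟩ := exists_norm_eq V.toSubmodule zero_le_one
  refine ⟨ψ, lam, fun l => ⟨hψ l, hV, hW l⟩, hlam, ?_, hsumEq, ?_⟩
  -- The weights are found by comparing traces at a single pure state of V.
  · have h := congrArg (LinearMap.trace ℂ L) (LinearMap.congr_fun hsumEq (pureState w₀))
    rw [LinearMap.comp_apply, trace_pinching hsum, LinearMap.comp_apply, htr, trace_inclEnd,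
      trace_pureState w₀ hw₀] at h
    simp only [LinearMap.sum_apply, LinearMap.smul_apply, LinearMap.comp_apply, map_sum, map_smul,
      trace_inclEnd, (hψ _).isQuantumChannel.trace_eq, trace_pureState w₀ hw₀] at h
    have h2 := congrArg Complex.re h
    simpa using h2
  · rw [hsumEq]
    have : Nonempty {w : V.toSubmodule // ‖w‖ = 1} := ⟨⟨w₀, hw₀⟩⟩
    refine le_ciInf fun w => ?_
    -- Boundedness is needed because a real infimum over an unbounded set takes a default value.
    have hbdd : BddBelow (Set.range fun u : {u : U // ‖u‖ = 1} => entropy (T (pureState u.1))) := by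
      refine ⟨0, ?_⟩
      rintro _ ⟨u, rfl⟩
      exact entropy_nonneg (hX.isPositive (isPositive_pureState _))
        (by rw [htr, trace_pureState _ u.2])
    refine (ciInf_le hbdd ⟨(w.1 : U), w.2⟩).trans ?_
    rw [LinearMap.comp_apply, LinearMap.comp_apply, inclEnd_pureState]
    exact entropy_le_entropy_pinching hsum (hX.isPositive (isPositive_pureState _))

end Subrepresentations

/-! ### Powers of linear forms as reproducing vectors; unitarity of `ρ m` -/

section Polynomials

open MvPolynomial

variable {m : ℕ}

/-- The underlying polynomial of an element of `P m`, as a linear map. -/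
def polyOf (m : ℕ) : P m →ₗ[ℂ] MvPolynomial (Fin 2) ℂ := P.toPoly m

theorem polyOf_injective : Function.Injective (polyOf m) := P.toPoly_injective

theorem polyOf_rho (g : SU2) (f : P m) :
    polyOf m (ρ m g f) = subst (g : Matrix (Fin 2) (Fin 2) ℂ) (polyOf m f) := rfl

/-- The element of `P m` given by a homogeneous polynomial. -/
def ofPoly {m : ℕ} (p : MvPolynomial (Fin 2) ℂ) (hp : p.IsHomogeneous m) : P m := ⟨p, hp⟩

@[simp] theorem polyOf_ofPoly (p : MvPolynomial (Fin 2) ℂ) (hp : p.IsHomogeneous m) :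
    polyOf m (ofPoly p hp) = p := rfl

/-- The exponent of `x₁ ^ l * x₂ ^ (m - l)`. -/
abbrev expo (m l : ℕ) : Fin 2 →₀ ℕ := Finsupp.single 0 l + Finsupp.single 1 (m - l)

theorem coeff_eq (f : P m) (l : Fin (m + 1)) :
    P.coeff f l = MvPolynomial.coeff (expo m l) (polyOf m f) := rfl

theorem expo_inj {l k : ℕ} : expo m l = expo m k ↔ l = k := by
  refine ⟨fun h => ?_, fun h => h ▸ rfl⟩
  simpa using DFunLike.congr_fun h 0

/-- The coefficients as a linear map. -/
def coeffs (m : ℕ) : P m →ₗ[ℂ] (Fin (m + 1) → ℂ) where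
  toFun := P.coeff
  map_add' f g := funext fun l => P.coeff_add f g l
  map_smul' c f := funext fun l => P.coeff_smul c f l

theorem coeffs_apply (f : P m) (l : Fin (m + 1)) : coeffs m f l = P.coeff f l := rfl

theorem coeffs_injective : Function.Injective (coeffs m) :=
  (injective_iff_map_eq_zero _).mpr fun f hf => P.eq_zero_of_coeff f fun l => congrFun hf l

/-- The monomial `x₁ ^ l * x₂ ^ (m - l)`. -/
def mono (m : ℕ) (l : Fin (m + 1)) : P m :=
  ofPoly (monomial (expo m l) 1) (by
    apply isHomogeneous_monomial
    rw [map_add, Finsupp.degree_single, Finsupp.degree_single]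
    omega)

theorem coeffs_mono (l : Fin (m + 1)) : coeffs m (mono m l) = Pi.single l 1 := by
  ext k
  rw [coeffs_apply, coeff_eq, mono, polyOf_ofPoly, coeff_monomial, Pi.single_apply]
  simp only [expo_inj, Fin.val_inj, eq_comm]

theorem eq_sum_mono (f : P m) : f = ∑ l, P.coeff f l • mono m l := by
  apply coeffs_injective
  ext k
  simp [coeffs_mono, Pi.single_apply]
  rfl

theorem finrank_P (m : ℕ) : Module.finrank ℂ (P m) = m + 1 := by
  have hs : Function.Surjective (coeffs m) := by
    intro v
    refine ⟨∑ l, v l • mono m l, ?_⟩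
    ext k
    simp [coeffs_mono, Pi.single_apply]
  rw [(LinearEquiv.ofBijective (coeffs m) ⟨coeffs_injective, hs⟩).finrank_eq]
  simp

theorem monomial_expo (l : ℕ) (c : ℂ) :
    monomial (expo m l) c = C c * (X 0 ^ l * X 1 ^ (m - l)) := by
  rw [X_pow_eq_monomial, X_pow_eq_monomial, monomial_mul, C_mul_monomial, mul_one,
    mul_one]

theorem eval_polyOf (f : P m) (v : Fin 2 → ℂ) :
    eval v (polyOf m f) = ∑ l : Fin (m + 1), P.coeff f l * (v 0 ^ (l : ℕ) * v 1 ^ (m - l)) := by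
  conv_lhs => rw [eq_sum_mono f]
  simp [mono, monomial_expo, smul_eval]

theorem eval_smul_polyOf (f : P m) (r : ℂ) (v : Fin 2 → ℂ) :
    eval (r • v) (polyOf m f) = r ^ m * eval v (polyOf m f) := by
  rw [eval_polyOf, eval_polyOf, Finset.mul_sum]
  refine Finset.sum_congr rfl fun l _ => ?_
  have : r ^ m = r ^ (l : ℕ) * r ^ (m - l) := by rw [← pow_add]; congr 1; omega
  rw [this]
  simp only [Pi.smul_apply, smul_eq_mul, mul_pow]
  ring

/-- The power `(a₀ x₁ + a₁ x₂) ^ m` of a linear form. -/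
def linPow (m : ℕ) (a : Fin 2 → ℂ) : P m :=
  ofPoly ((∑ i, C (a i) * X i) ^ m) (by
    have := (IsHomogeneous.sum Finset.univ (fun i => C (a i) * X (R := ℂ) i) 1
      fun i _ => (isHomogeneous_X ℂ i).C_mul _).pow m
    rwa [one_mul] at this)

theorem coeff_linPow (a : Fin 2 → ℂ) (l : Fin (m + 1)) :
    P.coeff (linPow m a) l = m.choose l * (a 0 ^ (l : ℕ) * a 1 ^ (m - l)) := by
  have h : ∀ k, (C (a 0) * X 0) ^ k * (C (a 1) * X 1) ^ (m - k) *
      (m.choose k : MvPolynomial (Fin 2) ℂ) =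
      monomial (expo m k) (m.choose k * (a 0 ^ k * a 1 ^ (m - k))) := by
    intro k
    rw [monomial_expo]
    simp only [C_mul, C_pow, mul_pow, map_natCast]
    ring
  rw [coeff_eq, linPow, polyOf_ofPoly, Fin.sum_univ_two, add_pow, coeff_sum]
  simp only [h, coeff_monomial, expo_inj]
  rw [Finset.sum_ite_eq' _ _ _, if_pos (Finset.mem_range.mpr l.2)]

/-- The weights l! (m - l)! of the inner product turn the binomial coefficients into the constant
m!, so pairing with a power of a linear form is evaluation at the conjugate point. -/
theorem inner_linPow (a : Fin 2 → ℂ) (f : P m) :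
    ⟪linPow m a, f⟫_ℂ = m.factorial * eval (fun i => conj (a i)) (polyOf m f) := by
  rw [P.inner_def, eval_polyOf, Finset.mul_sum]
  refine Finset.sum_congr rfl fun l _ => ?_
  rw [coeff_linPow, ← Nat.choose_mul_factorial_mul_factorial (Nat.lt_succ_iff.mp l.2)]
  simp only [map_mul, map_pow, Complex.conj_natCast]
  push_cast
  ring

theorem eval_subst (g : Matrix (Fin 2) (Fin 2) ℂ) (v : Fin 2 → ℂ) (p : MvPolynomial (Fin 2) ℂ) :
    eval v (subst g p) = eval (Matrix.vecMul v g) p := by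
  induction p using MvPolynomial.induction_on with
  | C a => simp [subst]
  | add p q hp hq => rw [map_add, map_add, map_add, hp, hq]
  | mul_X p j hp =>
    rw [map_mul, map_mul, map_mul, hp]
    simp [subst, Matrix.vecMul, dotProduct, mul_comm]

theorem rho_linPow (g : SU2) (a : Fin 2 → ℂ) :
    ρ m g (linPow m a) = linPow m (Matrix.mulVec (g : Matrix (Fin 2) (Fin 2) ℂ) a) := by
  apply polyOf_injective
  rw [polyOf_rho, linPow, linPow, polyOf_ofPoly, polyOf_ofPoly, map_pow, map_sum]
  congr 1
  simp only [subst, map_mul, algHom_C, aeval_X, Matrix.mulVec, dotProduct, Fin.sum_univ_two,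
    algebraMap_eq, C_add]
  ring

/-- A polynomial orthogonal to the powers of all normalized linear forms vanishes. -/
theorem eq_zero_of_inner_linPow (f : P m)
    (h : ∀ a : Fin 2 → ℂ, ‖a 0‖ ^ 2 + ‖a 1‖ ^ 2 = 1 → ⟪linPow m a, f⟫_ℂ = 0) : f = 0 := by
  have h1 : ∀ v : Fin 2 → ℂ, ‖v 0‖ ^ 2 + ‖v 1‖ ^ 2 = 1 → eval v (polyOf m f) = 0 := by
    intro v hv
    have := h (fun i => conj (v i)) (by simpa using hv)
    rw [inner_linPow] at this
    simpa [m.factorial_ne_zero] using this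
  -- The factor X 0 disposes of points with v 0 = 0, among them the origin, which cannot be rescaled
  -- to the unit sphere; it is cancelled at the end since the polynomial ring is a domain.
  have h2 : polyOf m f * X 0 = 0 := by
    apply MvPolynomial.funext
    intro v
    rw [map_mul, eval_X, map_zero]
    by_cases hv : v 0 = 0
    · rw [hv, mul_zero]
    have hpos : 0 < ‖v 0‖ ^ 2 + ‖v 1‖ ^ 2 := by
      have := norm_pos_iff.mpr hv
      positivity
    set r := Real.sqrt (‖v 0‖ ^ 2 + ‖v 1‖ ^ 2) with hr
    have hr0 : 0 < r := Real.sqrt_pos.mpr hpos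
    have hr2 : r ^ 2 = ‖v 0‖ ^ 2 + ‖v 1‖ ^ 2 := Real.sq_sqrt hpos.le
    have hrC : (r : ℂ) ≠ 0 := by exact_mod_cast hr0.ne'
    have hv' : v = (r : ℂ) • ((r : ℂ)⁻¹ • v) := by rw [smul_inv_smul₀ hrC]
    rw [hv', eval_smul_polyOf, h1]
    · simp
    · simp only [Pi.smul_apply, smul_eq_mul, norm_mul, norm_inv, Complex.norm_real,
        Real.norm_eq_abs, abs_of_pos hr0, mul_pow, ← mul_add, ← hr2]
      field_simp
  apply polyOf_injective
  rw [map_zero]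
  exact (mul_eq_zero.mp h2).resolve_right (X_ne_zero 0)

theorem coe_inv_SU2 (g : SU2) :
    ((g⁻¹ : SU2) : Matrix (Fin 2) (Fin 2) ℂ) =
      Matrix.conjTranspose (g : Matrix (Fin 2) (Fin 2) ℂ) :=
  rfl

/-- Tested against powers of linear forms, both sides become evaluations of f: g⁻¹ acts on the
coefficient vector a on one side, g on the evaluation point on the other, and they match because g⁻¹
= g*. -/
theorem isUnitaryRep_rho (m : ℕ) : IsUnitaryRep (ρ m) := by
  intro g
  suffices h : ∀ g : SU2, LinearMap.adjoint (ρ m g⁻¹) = ρ m g by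
    rw [← h g⁻¹, inv_inv]
  intro g
  ext1 f
  rw [← sub_eq_zero]
  refine eq_zero_of_inner_linPow _ fun a _ => ?_
  rw [inner_sub_right, LinearMap.adjoint_inner_right, rho_linPow, inner_linPow, inner_linPow,
    polyOf_rho, eval_subst, sub_eq_zero]
  congr 3
  ext j
  rw [coe_inv_SU2]
  simp [Matrix.mulVec, Matrix.vecMul, dotProduct, mul_comm]

end Polynomials

/-! ### Irreducibility of `ρ m` -/

section Irreducibility

open MvPolynomial

variable {m : ℕ}

/-- The element of `SU(2)` with first column a given unit vector. -/
def ofUnitVector (a : Fin 2 → ℂ) (ha : ‖a 0‖ ^ 2 + ‖a 1‖ ^ 2 = 1) : SU2 :=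
  ⟨!![a 0, -conj (a 1); a 1, conj (a 0)], by
    have h : a 0 * conj (a 0) + a 1 * conj (a 1) = 1 := by
      rw [Complex.mul_conj', Complex.mul_conj']
      exact_mod_cast ha
    rw [Matrix.mem_specialUnitaryGroup_iff, Matrix.mem_unitaryGroup_iff']
    constructor
    · rw [Matrix.star_eq_conjTranspose]
      ext i j
      fin_cases i <;> fin_cases j <;>
        simp [Matrix.mul_apply, Fin.sum_univ_two, Matrix.conjTranspose_apply] <;>
        first | linear_combination h | ring
    · rw [Matrix.det_fin_two_of]
      linear_combination h⟩

/-- All powers of normalized linear forms lie in the orbit of x₁ ^ m, so x₁ ^ m is a cyclic vector.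
-/
theorem rho_ofUnitVector_linPow (a : Fin 2 → ℂ) (ha : ‖a 0‖ ^ 2 + ‖a 1‖ ^ 2 = 1) :
    ρ m (ofUnitVector a ha) (linPow m ![1, 0]) = linPow m a := by
  rw [rho_linPow]
  congr 1
  ext i
  fin_cases i <;> simp [ofUnitVector, Matrix.mulVec, dotProduct]

theorem coeff_rho_torus (z : ℂ)
    (hz : ‖(![z, 0] : Fin 2 → ℂ) 0‖ ^ 2 + ‖(![z, 0] : Fin 2 → ℂ) 1‖ ^ 2 = 1) (f : P m)
    (l : Fin (m + 1)) :
    P.coeff (ρ m (ofUnitVector ![z, 0] hz) f) l =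
      z ^ (l : ℕ) * conj z ^ (m - l) * P.coeff f l := by
  have h : ∀ k : Fin (m + 1), ρ m (ofUnitVector ![z, 0] hz) (mono m k) =
      (z ^ (k : ℕ) * conj z ^ (m - k)) • mono m k := by
    intro k
    apply polyOf_injective
    rw [polyOf_rho, map_smul, mono, polyOf_ofPoly, monomial_expo, smul_eq_C_mul]
    simp [subst, ofUnitVector, mul_pow]
    ring
  have h2 : coeffs m (ρ m (ofUnitVector ![z, 0] hz) f) l =
      z ^ (l : ℕ) * conj z ^ (m - l) * P.coeff f l := by
    conv_lhs => rw [eq_sum_mono f]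
    simp only [map_sum, map_smul, h, coeffs_mono, Finset.sum_apply, Pi.smul_apply, Pi.single_apply,
      smul_eq_mul]
    simp [mul_comm]
  exact h2

/-- An operator commuting with `ρ m` is a scalar. -/
theorem eq_smul_id_of_commute_rho {T : Module.End ℂ (P m)}
    (hT : ∀ g f, T (ρ m g f) = ρ m g (T f)) : ∃ c : ℂ, T = c • LinearMap.id := by
  -- The weights of diag(z, z̄) are z ^ (2l - m). As 0 ≤ 2l ≤ 2m, order 2m + 1 makes them distinct,
  -- so one torus element separates all monomials.
  have hprim := Complex.isPrimitiveRoot_exp (2 * m + 1) (by omega)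
  set z := Complex.exp (2 * Real.pi * Complex.I / ((2 * m + 1 : ℕ) : ℂ)) with hzdef
  have hz1 : ‖z‖ = 1 := hprim.norm'_eq_one (by omega)
  have hz : ‖(![z, 0] : Fin 2 → ℂ) 0‖ ^ 2 + ‖(![z, 0] : Fin 2 → ℂ) 1‖ ^ 2 = 1 := by
    simp [hz1]
  have hzz : z * conj z = 1 := by rw [Complex.mul_conj', hz1]; simp
  have htop : ∀ l : Fin (m + 1),
      P.coeff (linPow m ![1, 0]) l = if l = Fin.last m then 1 else 0 := by
    intro l
    rw [coeff_linPow]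
    split_ifs with h
    · subst h; simp
    · have : m - (l : ℕ) ≠ 0 := by
        have := Fin.val_lt_last h
        omega
      simp [this]
  have htorus : ρ m (ofUnitVector ![z, 0] hz) (linPow m ![1, 0]) = z ^ m • linPow m ![1, 0] := by
    apply coeffs_injective
    ext l
    rw [coeffs_apply, coeff_rho_torus, map_smul, Pi.smul_apply, coeffs_apply, htop, smul_eq_mul]
    split_ifs with h
    · subst h; simp
    · simp
  -- T preserves the one-dimensional eigenspace of the torus element spanned by x₁ ^ m.
  obtain ⟨c, hc⟩ : ∃ c : ℂ, T (linPow m ![1, 0]) = c • linPow m ![1, 0] := by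
    refine ⟨P.coeff (T (linPow m ![1, 0])) (Fin.last m), ?_⟩
    have h1 := hT (ofUnitVector ![z, 0] hz) (linPow m ![1, 0])
    rw [htorus, map_smul] at h1
    apply coeffs_injective
    ext l
    rw [map_smul, Pi.smul_apply, coeffs_apply, coeffs_apply, htop, smul_eq_mul]
    split_ifs with h
    · subst h; simp
    · have h2 := congrFun (congrArg (coeffs m) h1) l
      rw [map_smul, Pi.smul_apply, coeffs_apply, coeffs_apply, coeff_rho_torus, smul_eq_mul] at h2
      rw [mul_zero]
      by_contra hne
      have h3 := mul_right_cancel₀ hne h2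
      have hlt := Fin.val_lt_last h
      have h4 : z ^ (2 * m) = z ^ (2 * (l : ℕ)) := by
        calc z ^ (2 * m) = z ^ m * z ^ m := by rw [← pow_add]; congr 1; omega
          _ = z ^ (l : ℕ) * conj z ^ (m - l) * (z ^ (l : ℕ) * z ^ (m - l)) := by
            rw [h3]
            congr 1
            rw [← h3, ← pow_add]
            congr 1
            omega
          _ = z ^ (2 * (l : ℕ)) * (z * conj z) ^ (m - l) := by rw [mul_pow, two_mul, pow_add]; ring
          _ = z ^ (2 * (l : ℕ)) := by rw [hzz]; simp
      have h5 := hprim.pow_inj (by omega) (by omega) h4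
      omega
  refine ⟨c, ?_⟩
  rw [← sub_eq_zero]
  -- T - c vanishes on x₁ ^ m, hence on its orbit, so the range of its adjoint is orthogonal to that
  -- orbit.
  have hadj : LinearMap.adjoint (T - c • LinearMap.id) = 0 := by
    ext1 f
    refine eq_zero_of_inner_linPow _ fun a ha => ?_
    rw [LinearMap.adjoint_inner_right, ← rho_ofUnitVector_linPow a ha, LinearMap.sub_apply, hT, hc]
    simp
  rw [← LinearMap.adjoint_adjoint (T - c • LinearMap.id), hadj, map_zero]

/-- Converse of Schur's lemma: the projection onto an invariant subspace commutes with π, and a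
scalar projection has range zero or everything. -/
theorem isIrreducible_of_commutant {H G : Type*} [NormedAddCommGroup H] [InnerProductSpace ℂ H]
    [FiniteDimensional ℂ H] [Nontrivial H] [Group G] {π : Representation ℂ G H}
    (hπ : IsUnitaryRep π)
    (h : ∀ T : Module.End ℂ H, (∀ g x, T (π g x) = π g (T x)) → ∃ c : ℂ, T = c • LinearMap.id) :
    π.IsIrreducible := by
  have hnt : Nontrivial (Subrepresentation π) := by
    refine ⟨⊥, ⊤, fun hbt => ?_⟩
    have h2 : (⊥ : Submodule ℂ H) = ⊤ := congrArg Subrepresentation.toSubmodule hbt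
    exact bot_ne_top h2
  refine { eq_bot_or_eq_top := fun W => ?_ }
  obtain ⟨c, hc⟩ := h W.toSubmodule.starProjection.toLinearMap fun g x =>
    congrArg Subtype.val (hπ.orthogonalProjectionOnto_rep W g x)
  have hc' : ∀ x, W.toSubmodule.starProjection x = c • x := fun x => LinearMap.congr_fun hc x
  by_cases hc0 : c = 0
  · left
    apply Subrepresentation.toSubmodule_injective
    refine (Submodule.eq_bot_iff _).mpr fun x hx => ?_
    rw [← W.toSubmodule.starProjection_eq_self_iff.mpr hx, hc', hc0, zero_smul]
  · right
    apply Subrepresentation.toSubmodule_injective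
    refine (Submodule.eq_top_iff').mpr fun x => ?_
    have h1 := W.toSubmodule.starProjection_apply_mem x
    rw [hc'] at h1
    exact (Submodule.smul_mem_iff _ hc0).mp h1

instance nontrivial_P (m : ℕ) : Nontrivial (P m) :=
  Module.nontrivial_of_finrank_pos (R := ℂ) (by rw [finrank_P]; omega)

theorem isIrreducible_rho (m : ℕ) : (ρ m).IsIrreducible :=
  isIrreducible_of_commutant (isUnitaryRep_rho m) fun _ hT => eq_smul_id_of_commute_rho hT

end Irreducibility

/-! ### The Clebsch–Gordan decomposition -/

section ClebschGordan

open MvPolynomial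

theorem isHomogeneous_polyOf {m : ℕ} (f : P m) : (polyOf m f).IsHomogeneous m :=
  P.isHomogeneous f

/-- Multiplication by a variable. -/
def mulX (m : ℕ) (j : Fin 2) : P m →ₗ[ℂ] P (m + 1) where
  toFun f := ofPoly (polyOf m f * X j) ((isHomogeneous_polyOf f).mul (isHomogeneous_X ℂ j))
  map_add' f h := polyOf_injective (by simp [add_mul])
  map_smul' c f := polyOf_injective (by simp)

theorem polyOf_mulX {m : ℕ} (j : Fin 2) (f : P m) :
    polyOf (m + 1) (mulX m j f) = polyOf m f * X j := rfl

theorem rho_mulX {m : ℕ} (g : SU2) (j : Fin 2) (f : P m) :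
    ρ (m + 1) g (mulX m j f) =
      ∑ i, (g : Matrix (Fin 2) (Fin 2) ℂ) i j • mulX m i (ρ m g f) := by
  apply polyOf_injective
  rw [polyOf_rho, polyOf_mulX, map_mul, map_sum]
  simp only [map_smul, polyOf_mulX, polyOf_rho, subst, aeval_X, Finset.mul_sum, smul_eq_C_mul]
  exact Finset.sum_congr rfl fun i _ => by ring

/-- Multiplication by the invariant `x₁ y₂ - x₂ y₁`, as a map `P a ⊗ P b → P (a+1) ⊗ P (b+1)`. -/
def mulDet (a b : ℕ) : P a ⊗[ℂ] P b →ₗ[ℂ] P (a + 1) ⊗[ℂ] P (b + 1) :=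
  TensorProduct.map (mulX a 0) (mulX b 1) - TensorProduct.map (mulX a 1) (mulX b 0)

/-- The form x₁ y₂ - x₂ y₁ is multiplied by det g = 1 under substitution. -/
theorem mulDet_comp_tprod (a b : ℕ) (g : SU2) :
    mulDet a b ∘ₗ ((ρ a).tprod (ρ b)) g =
      ((ρ (a + 1)).tprod (ρ (b + 1))) g ∘ₗ mulDet a b := by
  have hdet : (g : Matrix (Fin 2) (Fin 2) ℂ) 0 0 * (g : Matrix (Fin 2) (Fin 2) ℂ) 1 1 -
      (g : Matrix (Fin 2) (Fin 2) ℂ) 0 1 * (g : Matrix (Fin 2) (Fin 2) ℂ) 1 0 = 1 := by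
    rw [← Matrix.det_fin_two]
    exact (Matrix.mem_specialUnitaryGroup_iff.mp g.2).2
  apply TensorProduct.ext'
  intro f h
  simp only [Representation.tprod_apply, LinearMap.comp_apply, mulDet, LinearMap.sub_apply,
    TensorProduct.map_tmul, map_sub, rho_mulX, Fin.sum_univ_two, TensorProduct.add_tmul,
    TensorProduct.tmul_add, TensorProduct.smul_tmul_smul]
  rw [← one_smul ℂ (mulX a 0 (ρ a g f) ⊗ₜ[ℂ] mulX b 1 (ρ b g h) - _), ← hdet]
  module

/-- The embedding of `P a ⊗ P b` into polynomials with polynomial coefficients. -/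
def toPolyPoly (a b : ℕ) : P a ⊗[ℂ] P b →ₗ[ℂ] MvPolynomial (Fin 2) (MvPolynomial (Fin 2) ℂ) :=
  ((algebraTensorAlgEquiv ℂ (MvPolynomial (Fin 2) ℂ)).toLinearMap.restrictScalars ℂ) ∘ₗ
    TensorProduct.map (polyOf a) (polyOf b)

theorem toPolyPoly_injective (a b : ℕ) : Function.Injective (toPolyPoly a b) :=
  (algebraTensorAlgEquiv ℂ (MvPolynomial (Fin 2) ℂ)).injective.comp
    (TensorProduct.map_injective_of_flat_flat _ _ polyOf_injective polyOf_injective)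

theorem toPolyPoly_tmul {a b : ℕ} (f : P a) (h : P b) :
    toPolyPoly a b (f ⊗ₜ h) = C (polyOf a f) * MvPolynomial.map C (polyOf b h) := by
  simp [toPolyPoly, smul_eq_C_mul, algebraMap_eq]

theorem toPolyPoly_mulDet {a b : ℕ} (t : P a ⊗[ℂ] P b) :
    toPolyPoly (a + 1) (b + 1) (mulDet a b t) =
      (C (X 0) * X 1 - C (X 1) * X 0) * toPolyPoly a b t := by
  induction t with
  | zero => simp
  | add x y hx hy => rw [map_add, map_add, hx, hy, map_add, mul_add]
  | tmul f h =>
    simp only [mulDet, LinearMap.sub_apply, TensorProduct.map_tmul, map_sub, toPolyPoly_tmul,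
      polyOf_mulX, map_mul, map_X]
    ring

/-- In the polynomial ring in both sets of variables this is multiplication by a nonzero element of
a domain. -/
theorem mulDet_injective (a b : ℕ) : Function.Injective (mulDet a b) := by
  refine (injective_iff_map_eq_zero _).mpr fun t ht => ?_
  have h1 := toPolyPoly_mulDet t
  rw [ht, map_zero] at h1
  have hne : (C (X 0) * X 1 - C (X 1) * X 0 :
      MvPolynomial (Fin 2) (MvPolynomial (Fin 2) ℂ)) ≠ 0 := by
    intro h0
    have := congrArg (eval (![0, 1] : Fin 2 → MvPolynomial (Fin 2) ℂ)) h0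
    simp at this
  apply toPolyPoly_injective
  rw [map_zero]
  exact (mul_eq_zero.mp h1.symm).resolve_left hne

/-- Multiplication `P a ⊗ P b → P (a + b)`. -/
def mulPoly (a b : ℕ) : P a ⊗[ℂ] P b →ₗ[ℂ] P (a + b) :=
  TensorProduct.lift (LinearMap.mk₂ ℂ
    (fun f h => ofPoly (polyOf a f * polyOf b h)
      ((isHomogeneous_polyOf f).mul (isHomogeneous_polyOf h)))
    (fun f f' h => polyOf_injective (by simp [add_mul]))
    (fun c f h => polyOf_injective (by simp))
    (fun f h h' => polyOf_injective (by simp [mul_add]))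
    (fun c f h => polyOf_injective (by simp)))

theorem polyOf_mulPoly_tmul {a b : ℕ} (f : P a) (h : P b) :
    polyOf (a + b) (mulPoly a b (f ⊗ₜ h)) = polyOf a f * polyOf b h := rfl

theorem mulPoly_comp_tprod (a b : ℕ) (g : SU2) :
    mulPoly a b ∘ₗ ((ρ a).tprod (ρ b)) g = ρ (a + b) g ∘ₗ mulPoly a b := by
  apply TensorProduct.ext'
  intro f h
  apply polyOf_injective
  rw [LinearMap.comp_apply, LinearMap.comp_apply, Representation.tprod_apply,
    TensorProduct.map_tmul, polyOf_mulPoly_tmul, polyOf_rho, polyOf_rho, polyOf_rho,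
    polyOf_mulPoly_tmul, map_mul]

theorem mulPoly_ne_zero (a b : ℕ) : mulPoly a b ≠ 0 := by
  intro h
  have h1 := congrArg (polyOf (a + b))
    (LinearMap.congr_fun h (linPow a ![1, 0] ⊗ₜ linPow b ![1, 0]))
  rw [polyOf_mulPoly_tmul, LinearMap.zero_apply, map_zero] at h1
  simp [linPow, X_ne_zero] at h1

section Adjoint

variable {H K : Type*}
  [NormedAddCommGroup H] [InnerProductSpace ℂ H] [FiniteDimensional ℂ H]
  [NormedAddCommGroup K] [InnerProductSpace ℂ K] [FiniteDimensional ℂ K]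
  {G : Type*} [Group G]

/-- The adjoint of an intertwiner of unitary representations is an intertwiner. -/
theorem IsUnitaryRep.adjoint_comp {π : Representation ℂ G H} {σ : Representation ℂ G K}
    (hπ : IsUnitaryRep π) (hσ : IsUnitaryRep σ) {T : H →ₗ[ℂ] K}
    (hT : ∀ g, T ∘ₗ π g = σ g ∘ₗ T) (g : G) :
    LinearMap.adjoint T ∘ₗ σ g = π g ∘ₗ LinearMap.adjoint T := by
  have h := congrArg LinearMap.adjoint (hT g⁻¹)
  rw [LinearMap.adjoint_comp, LinearMap.adjoint_comp, hπ, hσ, inv_inv] at h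
  exact h.symm

theorem IsUnitaryRep.tprod {π : Representation ℂ G H} {σ : Representation ℂ G K}
    (hπ : IsUnitaryRep π) (hσ : IsUnitaryRep σ) : IsUnitaryRep (π.tprod σ) := by
  intro g
  rw [Representation.tprod_apply, TensorProduct.adjoint_map, hπ, hσ, Representation.tprod_apply]

end Adjoint

/-- The adjoint of multiplication starts in P a ⊗ P b, and each multiplication by the invariant
determinant raises both degrees by one. Degrees a + l and b + l avoid truncated subtraction. -/
theorem exists_intertwiner_add (a b l : ℕ) :
    ∃ T : P (a + b) →ₗ[ℂ] P (a + l) ⊗[ℂ] P (b + l), T ≠ 0 ∧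
      ∀ g, T ∘ₗ ρ (a + b) g = ((ρ (a + l)).tprod (ρ (b + l))) g ∘ₗ T := by
  induction l with
  | zero =>
    refine ⟨LinearMap.adjoint (mulPoly a b), fun h => mulPoly_ne_zero a b ?_,
      ((isUnitaryRep_rho a).tprod (isUnitaryRep_rho b)).adjoint_comp (isUnitaryRep_rho (a + b))
        (mulPoly_comp_tprod a b)⟩
    rw [← LinearMap.adjoint_adjoint (mulPoly a b), h, map_zero]
  | succ l ih =>
    obtain ⟨T, hT0, hT⟩ := ih
    refine ⟨mulDet (a + l) (b + l) ∘ₗ T, fun h => hT0 ?_, fun g => ?_⟩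
    · ext1 x
      apply mulDet_injective
      rw [LinearMap.zero_apply, map_zero]
      exact LinearMap.congr_fun h x
    · rw [LinearMap.comp_assoc, hT, ← LinearMap.comp_assoc, mulDet_comp_tprod,
        LinearMap.comp_assoc]
      rfl

/-- For `l ≤ min a b` there is an embedding `P (a + b - 2 l) → P a ⊗ P b`. -/
theorem exists_injective_intertwiner {a b l : ℕ} (hl : l ≤ min a b) :
    ∃ T : Representation.IntertwiningMap (ρ (a + b - 2 * l)) ((ρ a).tprod (ρ b)),
      Function.Injective T := by
  obtain ⟨a, rfl⟩ := Nat.exists_eq_add_of_le' (hl.trans (min_le_left _ _))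
  obtain ⟨b, rfl⟩ := Nat.exists_eq_add_of_le' (hl.trans (min_le_right _ _))
  have hn : a + l + (b + l) - 2 * l = a + b := by omega
  rw [hn]
  obtain ⟨T, hT0, hT⟩ := exists_intertwiner_add a b l
  have := isIrreducible_rho (a + b)
  refine ⟨⟨T, hT⟩, (Representation.IsIrreducible.injective_or_eq_zero
    (⟨T, hT⟩ : Representation.IntertwiningMap (ρ (a + b)) _)).resolve_right fun h => hT0 ?_⟩
  exact congrArg Representation.IntertwiningMap.toLinearMap h

/-- T'* T intertwines irreducible representations of different dimensions n + 1 and n' + 1, so it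
vanishes by Schur's lemma. -/
theorem range_isOrtho_range {H : Type*} [NormedAddCommGroup H] [InnerProductSpace ℂ H]
    [FiniteDimensional ℂ H] {σ : Representation ℂ SU2 H} (hσ : IsUnitaryRep σ) {n n' : ℕ}
    (hne : n ≠ n') (T : Representation.IntertwiningMap (ρ n) σ)
    (T' : Representation.IntertwiningMap (ρ n') σ) :
    LinearMap.range T.toLinearMap ⟂ LinearMap.range T'.toLinearMap := by
  have := isIrreducible_rho n
  have := isIrreducible_rho n'
  let S : Representation.IntertwiningMap (ρ n) (ρ n') :=
    ⟨LinearMap.adjoint T'.toLinearMap ∘ₗ T.toLinearMap, fun g => by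
      rw [LinearMap.comp_assoc, T.isIntertwining', ← LinearMap.comp_assoc,
        (isUnitaryRep_rho n').adjoint_comp hσ T'.isIntertwining', LinearMap.comp_assoc]⟩
  have hS : S = 0 := by
    refine (Representation.IsIrreducible.bijective_or_eq_zero S).resolve_left fun hb => hne ?_
    have := (LinearEquiv.ofBijective S.toLinearMap hb).finrank_eq
    rw [finrank_P, finrank_P] at this
    omega
  rw [Submodule.isOrtho_iff_inner_eq]
  rintro _ ⟨x, rfl⟩ _ ⟨y, rfl⟩
  rw [← LinearMap.adjoint_inner_left]
  have h0 : LinearMap.adjoint T'.toLinearMap (T.toLinearMap x) = 0 :=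
    LinearMap.congr_fun (congrArg Representation.IntertwiningMap.toLinearMap hS) x
  rw [h0, inner_zero_left]

theorem orthogonalFamily_componentSpace (a b : ℕ) :
    OrthogonalFamily ℂ (fun l : Fin (min a b + 1) => componentSpace a b l)
      fun l => (componentSpace a b l).subtypeₗᵢ := by
  have hσ := (isUnitaryRep_rho a).tprod (isUnitaryRep_rho b)
  refine OrthogonalFamily.of_pairwise fun l k hlk => ?_
  change (⨆ T, _) ⟂ (⨆ T, _)
  simp only [Submodule.isOrtho_iSup_left, Submodule.isOrtho_iSup_right]
  intro T' T
  refine range_isOrtho_range hσ ?_ _ _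
  have := l.2
  have := k.2
  have h : (l : ℕ) ≠ k := fun h => hlk (Fin.ext h)
  omega

/-- Read backwards, the summands form the arithmetic progression 2i + (max a b - min a b) + 1. -/
theorem sum_add_sub_two_mul (a b : ℕ) :
    ∑ l : Fin (min a b + 1), (a + b - 2 * (l : ℕ) + 1) = (a + 1) * (b + 1) := by
  have key : ∀ c n, ∑ i ∈ Finset.range (n + 1), (2 * i + c + 1) = (n + c + 1) * (n + 1) := by
    intro c n
    induction n with
    | zero => simp
    | succ n ih => rw [Finset.sum_range_succ, ih]; ring
  rw [Fin.sum_univ_eq_sum_range (fun l => a + b - 2 * l + 1), ← Finset.sum_range_reflect]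
  have h : ∀ i ∈ Finset.range (min a b + 1),
      a + b - 2 * (min a b + 1 - 1 - i) + 1 = 2 * i + (max a b - min a b) + 1 := by
    intro i hi
    rw [Finset.mem_range] at hi
    omega
  rw [Finset.sum_congr rfl h, key]
  rcases le_total a b with hab | hab
  · rw [min_eq_left hab, max_eq_right hab, Nat.add_sub_cancel' hab, mul_comm]
  · rw [min_eq_right hab, max_eq_left hab, Nat.add_sub_cancel' hab]

/-! ### Orthogonal families that exhaust the space by dimension -/

section Sum

variable {H : Type*} [NormedAddCommGroup H] [InnerProductSpace ℂ H] [FiniteDimensional ℂ H]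
  {ι : Type*} [Fintype ι] {V : ι → Submodule ℂ H}

/-- The sum map of a family of subspaces. -/
def sumMap (V : ι → Submodule ℂ H) : (∀ i, V i) →ₗ[ℂ] H :=
  ∑ i, (V i).subtype ∘ₗ LinearMap.proj i

theorem sumMap_apply (V : ι → Submodule ℂ H) (x : ∀ i, V i) : sumMap V x = ∑ i, (x i : H) := by
  simp [sumMap]

theorem sumMap_injective (hV : OrthogonalFamily ℂ (fun i => V i) fun i => (V i).subtypeₗᵢ) :
    Function.Injective (sumMap V) := by
  refine (injective_iff_map_eq_zero _).mpr fun x hx => ?_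
  ext1 i
  rw [sumMap_apply] at hx
  have h := hV.inner_right_fintype x i (x i)
  simp only [Submodule.coe_subtypeₗᵢ, Submodule.subtype_apply] at h
  rw [hx, inner_zero_right] at h
  exact inner_self_eq_zero.mp h.symm

theorem sum_finrank_le (hV : OrthogonalFamily ℂ (fun i => V i) fun i => (V i).subtypeₗᵢ) :
    ∑ i, Module.finrank ℂ (V i) ≤ Module.finrank ℂ H := by
  rw [← Module.finrank_pi_fintype]
  exact LinearMap.finrank_le_finrank_of_injective (sumMap_injective hV)

/-- Orthogonality makes the sum map injective; equal dimensions make it surjective, so every vector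
lies in the span of the family. -/
theorem sum_starProjection_of_sum_finrank
    (hV : OrthogonalFamily ℂ (fun i => V i) fun i => (V i).subtypeₗᵢ)
    (h : ∑ i, Module.finrank ℂ (V i) = Module.finrank ℂ H) (v : H) :
    ∑ i, (V i).starProjection v = v := by
  rw [← Module.finrank_pi_fintype] at h
  obtain ⟨x, rfl⟩ := (LinearMap.injective_iff_surjective_of_finrank_eq_finrank h).mp
    (sumMap_injective hV) v
  refine hV.sum_projection_of_mem_iSup _ ?_
  rw [sumMap_apply]
  exact Submodule.sum_mem _ fun i _ => Submodule.mem_iSup_of_mem i (x i).2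

end Sum

theorem range_le_componentSpace {a b l : ℕ}
    (T : Representation.IntertwiningMap (ρ (a + b - 2 * l)) ((ρ a).tprod (ρ b))) :
    LinearMap.range T.toLinearMap ≤ componentSpace a b l :=
  le_iSup (fun T : Representation.IntertwiningMap (ρ (a + b - 2 * l)) ((ρ a).tprod (ρ b)) =>
    LinearMap.range T.toLinearMap) T

theorem le_finrank_componentSpace {a b l : ℕ} (hl : l ≤ min a b) :
    a + b - 2 * l + 1 ≤ Module.finrank ℂ (componentSpace a b l) := by
  obtain ⟨T, hT⟩ := exists_injective_intertwiner hl
  rw [← finrank_P, ← LinearMap.finrank_range_of_inj (f := T.toLinearMap) hT]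
  exact Submodule.finrank_mono (range_le_componentSpace T)

theorem finrank_tensor_P (a b : ℕ) :
    Module.finrank ℂ (P a ⊗[ℂ] P b) = (a + 1) * (b + 1) := by
  rw [Module.finrank_tensorProduct, finrank_P, finrank_P]

/-- A squeeze: orthogonality bounds the sum above, and the embeddings bound each term below by
numbers already summing to (a + 1)(b + 1). -/
theorem sum_finrank_componentSpace (a b : ℕ) :
    ∑ l : Fin (min a b + 1), Module.finrank ℂ (componentSpace a b l) =
      Module.finrank ℂ (P a ⊗[ℂ] P b) := by
  refine le_antisymm (sum_finrank_le (orthogonalFamily_componentSpace a b)) ?_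
  rw [finrank_tensor_P, ← sum_add_sub_two_mul]
  exact Finset.sum_le_sum fun l _ => le_finrank_componentSpace (Nat.lt_succ_iff.mp l.2)

/-- Equality of the sums forces equality in every termwise bound. This is where multiplicity one
comes from: the supremum over all intertwiners is no larger than one copy. -/
theorem finrank_componentSpace {a b l : ℕ} (hl : l ≤ min a b) :
    Module.finrank ℂ (componentSpace a b l) = a + b - 2 * l + 1 := by
  have h := sum_finrank_componentSpace a b
  rw [finrank_tensor_P, ← sum_add_sub_two_mul] at h
  exact ((Finset.sum_eq_sum_iff_of_le fun k _ =>
    le_finrank_componentSpace (Nat.lt_succ_iff.mp (Fin.is_lt k))).mp h.symm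
      ⟨l, Nat.lt_succ_iff.mpr hl⟩ (Finset.mem_univ _)).symm

/-- The Clebsch–Gordan decomposition is complete. -/
theorem sum_starProjection_componentSpace (a b : ℕ) (v : P a ⊗[ℂ] P b) :
    ∑ l : Fin (min a b + 1), (componentSpace a b l).starProjection v = v :=
  sum_starProjection_of_sum_finrank (orthogonalFamily_componentSpace a b)
    (sum_finrank_componentSpace a b) v

theorem isIrreducible_of_bijective {k G V W : Type*} [Field k] [Group G] [AddCommGroup V]
    [Module k V] [AddCommGroup W] [Module k W] {π : Representation k G V}
    {σ : Representation k G W} (hπ : π.IsIrreducible)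
    (f : Representation.IntertwiningMap π σ) (hf : Function.Bijective f) : σ.IsIrreducible := by
  rw [Representation.irreducible_iff_isSimpleModule_asModule] at hπ ⊢
  have e := LinearEquiv.ofBijective (Representation.IntertwiningMap.equivLinearMapAsModule π σ f) hf
  exact IsSimpleModule.congr e.symm

/-- By dimension a single embedded copy fills the component, so irreducibility transfers from `ρ (a
+ b - 2 * l)`. -/
theorem isIrreducible_componentRep {a b l : ℕ} (hl : l ≤ min a b) :
    (componentRep a b l).IsIrreducible := by
  obtain ⟨T, hT⟩ := exists_injective_intertwiner hl
  let f : Representation.IntertwiningMap (ρ (a + b - 2 * l)) (componentRep a b l) :=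
    ⟨T.toLinearMap.codRestrict _ fun x => range_le_componentSpace T ⟨x, rfl⟩, fun g => by
      ext x
      exact LinearMap.congr_fun (T.isIntertwining' g) x⟩
  have hinj : Function.Injective f.toLinearMap := fun x y hxy =>
    hT (congrArg Subtype.val hxy)
  have hfr : Module.finrank ℂ (P (a + b - 2 * l)) = Module.finrank ℂ (componentSpace a b l) := by
    rw [finrank_P, finrank_componentSpace hl]
  exact isIrreducible_of_bijective (isIrreducible_rho _) f
    ⟨hinj, (LinearMap.injective_iff_surjective_of_finrank_eq_finrank hfr).mp hinj⟩

end ClebschGordan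

end SU2Channels

end

open SU2Channels in
theorem corollary4p6 (r₁ r₂ m₁ m₂ : ℕ)
    (Φ₁ : Module.End ℂ (P r₁) →ₗ[ℂ] Module.End ℂ (P m₁))
    (Φ₂ : Module.End ℂ (P r₂) →ₗ[ℂ] Module.End ℂ (P m₂))
    (hΦ₁ : IsCovariantChannel (ρ r₁) (ρ m₁) Φ₁)
    (hΦ₂ : IsCovariantChannel (ρ r₂) (ρ m₂) Φ₂)
    (k : ℕ) (hk : k ≤ min r₁ r₂) :
    ∃ (ψ : ∀ l : Fin (min m₁ m₂ + 1),
          Module.End ℂ (componentSpace r₁ r₂ k) →ₗ[ℂ] Module.End ℂ (componentSpace m₁ m₂ l))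
      (lam : Fin (min m₁ m₂ + 1) → ℝ),
      (∀ l : Fin (min m₁ m₂ + 1),
        IsIrreduciblyCovariantChannel (componentRep r₁ r₂ k) (componentRep m₁ m₂ l) (ψ l)) ∧
      (∀ l, 0 ≤ lam l) ∧
      ∑ l, lam l = 1 ∧
      ∑ l, (lam l : ℂ) • (inclEnd (componentSpace m₁ m₂ l) ∘ₗ ψ l) =
        pinching (fun l : Fin (min m₁ m₂ + 1) => componentSpace m₁ m₂ l) ∘ₗ
          tensorMap Φ₁ Φ₂ ∘ₗ inclEnd (componentSpace r₁ r₂ k) ∧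
      minOutputEntropy (tensorMap Φ₁ Φ₂) ≤
        minOutputEntropy (H := componentSpace r₁ r₂ k) (K := P m₁ ⊗[ℂ] P m₂)
          (∑ l, (lam l : ℂ) • (inclEnd (componentSpace m₁ m₂ l) ∘ₗ ψ l)) := by
  obtain ⟨_, X₁, hX₁⟩ := hΦ₁.isQuantumChannel.completelyPositive.exists_isKraus
  obtain ⟨_, X₂, hX₂⟩ := hΦ₂.isQuantumChannel.completelyPositive.exists_isKraus
  exact exists_pinching_decomposition
    ((isUnitaryRep_rho r₁).tprod (isUnitaryRep_rho r₂))
    ((isUnitaryRep_rho m₁).tprod (isUnitaryRep_rho m₂))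
    (hX₁.tensorMap hX₂)
    (trace_tensorMap hΦ₁.isQuantumChannel.trace_eq hΦ₂.isQuantumChannel.trace_eq)
    (tensorMap_covariant hΦ₁ hΦ₂) (component r₁ r₂ k) (isIrreducible_componentRep hk)
    (fun l : Fin (min m₁ m₂ + 1) => component m₁ m₂ l)
    (fun l => isIrreducible_componentRep (Nat.lt_succ_iff.mp l.2))
    (sum_starProjection_componentSpace m₁ m₂)
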